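/- Let $I$ and $J$ be disjoint index sets, and let $\mathbb{C}_0\langle\langle z_k : k\in I\sqcup J\rangle\rangle$ be the set of formal series with complex coefficients and zero constant term in the non-commuting indeterminates $z_k$, $k\in I\sqcup J$. **Partitions.** For $\chi:\{1,\dots,n\}\to\{\ell,r\}$ with $\chi^{-1}(\ell)=\{i_1<\dots<i_p\}$ and $\chi^{-1}(r)=\{i_{p+1}>\dots>i_n\}$, let $s_\chi$ be the permutation $s_\chi(j)=i_j$, and order $\{1,\dots,n\}$ by $i_1\prec_\chi\cdots\prec_\chi i_n$. Let $\mathcal{BNC}(\chi)$ be the set of partitions $\pi$ of $\{1,\dots,n\}$ such that $s_\chi^{-1}\cdot\pi$ is non-crossing, and let $\mathcal{BI}(\chi)\subseteq\mathcal{BNC}(\chi)$ be the set of those all of whose blocks are intervals for $\prec_\chi$. For $\pi\in\mathcal{BNC}(\chi)$, the bi-non-crossing Kreweras complement is $K_{\mathcal{BNC}}(\pi)=s_\chi\cdot K_{\mathcal{NC}}(s_\chi^{-1}\cdot\pi)$. Here, for a non-crossing partition $\rho$ of $\{1,\dots,n\}$, $K_{\mathcal{NC}}(\rho)$ is the largest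 (in the refinement order) partition $\sigma$ of $\{\bar 1,\dots,\bar n\}\cong\{1,\dots,n\}$ such that $\rho\cup\sigma$ is non-crossing on $1<\bar1<2<\bar2<\dots<n<\bar n$. **Transforms.** Let $\varphi$ be a unital linear functional on a unital complex algebra $A$. The $(\ell,r)$-cumulants $\kappa_\chi$ and the B-$(\ell,r)$-cumulants $B_\chi$ of $\varphi$ are the functionals on $A^n$ ($n\ge1$, $\chi:\{1,\dots,n\}\to\{\ell,r\}$) uniquely determined by $$\varphi(a_1\cdots a_n)=\sum_{\pi\in\mathcal{BNC}(\chi)}\prod_{V\in\pi}\kappa_{\chi|_V}\big((a_1,\dots,a_n)|_V\big)=\sum_{\pi\in\mathcal{BI}(\chi)}\prod_{V\in\pi}B_{\chi|_V}\big((a_1,\dots,a_n)|_V\big)$$ for all $n\ge1$, all $\chi$ and all $a_1,\dots,a_n\in A$. For $\alpha:\{1,\dots,n\}\to I\sqcup J$, let $\chi_\alpha(k)=\ell$ if $\alpha(k)\in I$ and $\chi_\alpha(k)=r$ if $\alpha(k)\in J$. For a unital linear functional $\mu$ on $\mathbb{C}\langle Z_k:k\in I\sqcup J\rangle$, let $\mathcal{R}_\mu$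 and $\eta_\mu$ be the series in $\mathbb{C}_0\langle\langle z_k : k\in I\sqcup J\rangle\rangle$ whose coefficients of $z_{\alpha(1)}\cdots z_{\alpha(n)}$ are $\kappa_{\chi_\alpha}(Z_{\alpha(1)},\dots,Z_{\alpha(n)})$ and $B_{\chi_\alpha}(Z_{\alpha(1)},\dots,Z_{\alpha(n)})$ respectively, both taken with respect to $\mu$. The maps $\mathcal{R}:\mu\mapsto\mathcal{R}_\mu$ and $\eta:\mu\mapsto\eta_\mu$ are bijections from the set of unital linear functionals on $\mathbb{C}\langle Z_k:k\in I\sqcup J\rangle$ onto $\mathbb{C}_0\langle\langle z_k : k\in I\sqcup J\rangle\rangle$. Put $\mathrm{bReta}=\eta\circ\mathcal{R}^{-1}$. **Twisted boxed convolution.** Write $\mathrm{Cf}_{\alpha}(f)$ for the coefficient of $z_{\alpha(1)}\cdots z_{\alpha(n)}$ in $f$, and $\mathrm{Cf}_{\alpha;\pi}(f)=\prod_{V\in\pi}\mathrm{Cf}_{\alpha|_V}(f)$ for a partition $\pi$ of $\{1,\dots,n\}$. For $f,g\in\mathbb{C}_0\langle\langle z_k : k\in I\sqcup J\rangle\rangle$,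 define $f\,\widetilde{\star}\,g\in\mathbb{C}_0\langle\langle z_k : k\in I\sqcup J\rangle\rangle$ by $$\mathrm{Cf}_\alpha(f\,\widetilde{\star}\,g)=\sum_{\pi\in\mathcal{BNC}(\chi_\alpha)}\mathrm{Cf}_{\alpha;\pi}(f)\,\mathrm{Cf}_{\alpha;K_{\mathcal{BNC}}(\pi)}(g)\qquad(n\ge1,\ \alpha:\{1,\dots,n\}\to I\sqcup J).$$ **Theorem.** For all $f,g\in\mathbb{C}_0\langle\langle z_k:k\in I\sqcup J\rangle\rangle$, $$\mathrm{bReta}(f\,\widetilde{\star}\,g)=\mathrm{bReta}(f)\,\widetilde{\star}\,\mathrm{bReta}(g).$$ -/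

import Mathlib

open scoped BigOperators

/-! ### Partitions, non-crossing partitions and the Kreweras complement

Partitions of the linearly ordered set `{1, …, n}` are Mathlib's
`Finpartition (Finset.univ : Finset (Fin n))`; the order on them is refinement. -/

/-- A partition of an `n`-element linearly ordered set. -/
abbrev Partn (n : ℕ) : Type := Finpartition (Finset.univ : Finset (Fin n))

/-- A collection of blocks is non-crossing if there are no `a < b < c < d` with `a, c` in one block
and `b, d` in a different one. -/
def NonCrossing {α : Type*} [LinearOrder α] (P : Finset (Finset α)) : Prop :=
  ∀ V ∈ P, ∀ W ∈ P, ∀ a b c d : α, a < b → b < c → c < d →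
    a ∈ V → c ∈ V → b ∈ W → d ∈ W → V = W

/-- The partition `s · π`, obtained by applying the permutation `s` to the blocks of `π`. -/
def Partn.permute {n : ℕ} (s : Equiv.Perm (Fin n)) (π : Partn n) : Partn n where
  parts := π.parts.map s.finsetCongr.toEmbedding
  supIndep := by
    rw [Finset.supIndep_iff_pairwiseDisjoint]
    intro V hV W hW hne
    simp only [Finset.coe_map, Set.mem_image, Finset.mem_coe] at hV hW
    obtain ⟨V, hV, rfl⟩ := hV
    obtain ⟨W, hW, rfl⟩ := hW
    have h : V ≠ W := fun h => hne (by rw [h])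
    have := π.disjoint hV hW h
    simpa [Function.onFun] using this
  sup_parts := by
    ext x
    obtain ⟨V, hV, hx⟩ := π.exists_mem (Finset.mem_univ (s.symm x))
    simp only [Finset.mem_univ, iff_true, Finset.mem_sup, Finset.mem_map]
    exact ⟨_, ⟨V, hV, rfl⟩, by simpa using hx⟩
  bot_notMem := by
    simp only [Finset.mem_map, not_exists, not_and]
    intro V hV h
    exact π.ne_bot hV (by simpa using h)

/-- Write `ī` for a point placed immediately after `i`. Then `ī` and `j̄` are related if every block
of `π` lies entirely inside or entirely outside the set of points between `ī` and `j̄`. -/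
def krewerasSetoid {n : ℕ} (π : Partn n) : Setoid (Fin n) where
  r i j := ∀ V ∈ π.parts, V ⊆ Finset.Ioc (min i j) (max i j) ∨
    Disjoint V (Finset.Ioc (min i j) (max i j))
  iseqv := by
    have key : ∀ i j : Fin n, (∀ V ∈ π.parts, V ⊆ Finset.Ioc (min i j) (max i j) ∨
        Disjoint V (Finset.Ioc (min i j) (max i j))) ↔
        ∀ V ∈ π.parts, ∀ a ∈ V, ∀ b ∈ V, ((i < a ↔ j < a) ↔ (i < b ↔ j < b)) := by
      intro i j
      have hm : ∀ a : Fin n, a ∈ Finset.Ioc (min i j) (max i j) ↔ ¬ (i < a ↔ j < a) := by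
        intro a
        rw [Finset.mem_Ioc]
        rcases le_total i j with h | h
        · rw [min_eq_left h, max_eq_right h]; omega
        · rw [min_eq_right h, max_eq_left h]; omega
      refine forall₂_congr fun V hV => ?_
      constructor
      · rintro (h | h) a ha b hb
        · have h1 := (hm a).1 (h ha)
          have h2 := (hm b).1 (h hb)
          tauto
        · have h1 := (hm a).not.1 (Finset.disjoint_left.1 h ha)
          have h2 := (hm b).not.1 (Finset.disjoint_left.1 h hb)
          tauto
      · intro h
        obtain ⟨a, ha⟩ := π.nonempty_of_mem_parts hV
        by_cases h1 : (i < a ↔ j < a)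
        · right
          rw [Finset.disjoint_left]
          intro b hb
          rw [hm b]
          have := h a ha b hb
          tauto
        · left
          intro b hb
          rw [hm b]
          have := h a ha b hb
          tauto
    refine ⟨fun i => ?_, fun {i j} h => ?_, fun {i j k} h1 h2 => ?_⟩
    · simp
    · simpa only [min_comm, max_comm] using h
    · rw [key] at *
      intro V hV a ha b hb
      have := h1 V hV a ha b hb
      have := h2 V hV a ha b hb
      tauto

instance {n : ℕ} (π : Partn n) : DecidableRel (krewerasSetoid π).r := fun i j =>
  inferInstanceAs (Decidable (∀ V ∈ π.parts, V ⊆ Finset.Ioc (min i j) (max i j) ∨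
    Disjoint V (Finset.Ioc (min i j) (max i j))))

/-- The Kreweras complement `K_NC(π)`. For non-crossing `π` it is the largest partition `σ` of
`1̄, …, n̄` such that `π ∪ σ` is non-crossing for the order `1 < 1̄ < 2 < 2̄ < ⋯ < n < n̄`;
this is proved in `kreweras_isGreatest`. -/
def kreweras {n : ℕ} (π : Partn n) : Partn n := Finpartition.ofSetoid (krewerasSetoid π)

/-- The blocks of `π ∪ σ`, with `π` living on `1, …, n` and `σ` on `1̄, …, n̄`, where
`1 < 1̄ < 2 < 2̄ < ⋯ < n < n̄` (encoded as `0 < 1 < 2 < 3 < ⋯`). -/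
def interleave {n : ℕ} (π σ : Partn n) : Finset (Finset ℕ) :=
  π.parts.image (fun V => V.image fun i : Fin n => 2 * (i : ℕ)) ∪
    σ.parts.image (fun V => V.image fun i : Fin n => 2 * (i : ℕ) + 1)

theorem kreweras_rel {n : ℕ} {π : Partn n} {V : Finset (Fin n)} (hV : V ∈ (kreweras π).parts)
    {i j : Fin n} (hi : i ∈ V) (hj : j ∈ V) : krewerasSetoid π i j := by
  rw [← (kreweras π).part_eq_of_mem hV hi] at hj
  exact Finpartition.mem_part_ofSetoid_iff_rel.1 hj

theorem kreweras_isGreatest {n : ℕ} (π : Partn n) (hπ : NonCrossing π.parts) :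
    IsGreatest {σ : Partn n | NonCrossing (interleave π σ)} (kreweras π) := by
  have hmem : ∀ (σ : Partn n) (V : Finset ℕ), V ∈ interleave π σ ↔
      (∃ U ∈ π.parts, U.image (fun i : Fin n => 2 * (i : ℕ)) = V) ∨
      (∃ U ∈ σ.parts, U.image (fun i : Fin n => 2 * (i : ℕ) + 1) = V) := by
    intro σ V
    simp only [interleave, Finset.mem_union, Finset.mem_image]
  constructor
  · intro V hV' W hW' a b c d hab hbc hcd ha hc hb hd
    rcases (hmem _ _).1 hV' with ⟨V, hV, rfl⟩ | ⟨V, hV, rfl⟩ <;>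
    rcases (hmem _ _).1 hW' with ⟨W, hW, rfl⟩ | ⟨W, hW, rfl⟩ <;>
    · simp only [Finset.mem_image] at ha hb hc hd
      obtain ⟨a, ha, rfl⟩ := ha
      obtain ⟨b, hb, rfl⟩ := hb
      obtain ⟨c, hc, rfl⟩ := hc
      obtain ⟨d, hd, rfl⟩ := hd
      first
      | rw [hπ V hV W hW a b c d (by omega) (by omega) (by omega) ha hc hb hd]
      | exfalso
        have hbd : b ≤ d := by omega
        have h := kreweras_rel hW hb hd V hV
        rw [min_eq_left hbd, max_eq_right hbd] at h
        rcases h with h | h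
        · have := Finset.mem_Ioc.1 (h ha)
          omega
        · exact Finset.disjoint_left.1 h hc (Finset.mem_Ioc.2 (by omega))
      | exfalso
        have hac : a ≤ c := by omega
        have h := kreweras_rel hV ha hc W hW
        rw [min_eq_left hac, max_eq_right hac] at h
        rcases h with h | h
        · have := Finset.mem_Ioc.1 (h hd)
          omega
        · exact Finset.disjoint_left.1 h hb (Finset.mem_Ioc.2 (by omega))
      | have hac : a ≤ c := by omega
        have hbd : b ≤ d := by omega
        have hbc : b ≤ c := by omega
        have h : krewerasSetoid π b c := by
          intro U hU
          have h1 := kreweras_rel hV ha hc U hU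
          have h2 := kreweras_rel hW hb hd U hU
          rw [min_eq_left hac, max_eq_right hac, Finset.disjoint_left] at h1
          rw [min_eq_left hbd, max_eq_right hbd, Finset.disjoint_left] at h2
          rw [min_eq_left hbc, max_eq_right hbc, Finset.disjoint_left]
          rcases h1 with h1 | h1
          · rcases h2 with h2 | h2
            · left
              intro x hx
              have e1 := Finset.mem_Ioc.1 (h1 hx)
              have e2 := Finset.mem_Ioc.1 (h2 hx)
              exact Finset.mem_Ioc.2 ⟨e2.1, e1.2⟩
            · right
              intro x hx e
              have e := Finset.mem_Ioc.1 e
              exact h2 hx (Finset.mem_Ioc.2 ⟨e.1, by omega⟩)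
          · right
            intro x hx e
            have e := Finset.mem_Ioc.1 e
            exact h1 hx (Finset.mem_Ioc.2 ⟨by omega, e.2⟩)
        have hc' : c ∈ (kreweras π).part b := Finpartition.mem_part_ofSetoid_iff_rel.2 h
        rw [(kreweras π).part_eq_of_mem hW hb] at hc'
        rw [(kreweras π).eq_of_mem_parts hV hW hc hc']
  · intro σ hσ V hV
    obtain ⟨i, hi⟩ := σ.nonempty_of_mem_parts hV
    refine ⟨(kreweras π).part i, (kreweras π).part_mem.2 (Finset.mem_univ i), fun j hj => ?_⟩
    refine Finpartition.mem_part_ofSetoid_iff_rel.2 ?_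
    have key : ∀ i ∈ V, ∀ j ∈ V, i ≤ j → krewerasSetoid π i j := by
      intro i hi j hj hij U hU
      rw [min_eq_left hij, max_eq_right hij]
      by_contra! hcon
      obtain ⟨h1, h2⟩ := hcon
      obtain ⟨a, ha, ha'⟩ := Finset.not_subset.1 h1
      obtain ⟨b, hb, hb'⟩ := Finset.not_disjoint_iff.1 h2
      rw [Finset.mem_Ioc] at ha' hb'
      have hV' := (hmem σ _).2 (Or.inr ⟨V, hV, rfl⟩)
      have hU' := (hmem σ _).2 (Or.inl ⟨U, hU, rfl⟩)
      have mV : ∀ x ∈ V, 2 * (x : ℕ) + 1 ∈ V.image (fun i : Fin n => 2 * (i : ℕ) + 1) :=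
        fun x hx => Finset.mem_image.2 ⟨x, hx, rfl⟩
      have mU : ∀ x ∈ U, 2 * (x : ℕ) ∈ U.image (fun i : Fin n => 2 * (i : ℕ)) :=
        fun x hx => Finset.mem_image.2 ⟨x, hx, rfl⟩
      have hne : U.image (fun i : Fin n => 2 * (i : ℕ)) ≠
          V.image (fun i : Fin n => 2 * (i : ℕ) + 1) := by
        intro h
        have := mU a ha
        rw [h] at this
        obtain ⟨x, _, hx⟩ := Finset.mem_image.1 this
        omega
      rcases le_or_gt a i with h | h
      · exact hne (hσ _ hU' _ hV' _ _ _ _ (by omega) (by omega) (by omega)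
          (mU a ha) (mU b hb) (mV i hi) (mV j hj))
      · exact hne.symm (hσ _ hV' _ hU' _ _ _ _ (by omega) (by omega) (by omega)
          (mV i hi) (mV j hj) (mU b hb) (mU a ha))
    rcases le_total i j with h | h
    · exact key i hi j hj h
    · exact (krewerasSetoid π).symm (key j hj i hi h)

/-! ### Left and right faces, bi-non-crossing partitions -/

/-- The two faces: left and right. -/
inductive Face : Type
  | left
  | right
  deriving DecidableEq

/-- The left indices in increasing order, followed by the right indices in decreasing order. -/
def chiList {n : ℕ} (χ : Fin n → Face) : List (Fin n) :=
  (List.finRange n).filter (fun i => χ i = Face.left) ++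
    ((List.finRange n).filter (fun i => χ i = Face.right)).reverse

theorem mem_chiList {n : ℕ} (χ : Fin n → Face) (i : Fin n) : i ∈ chiList χ := by
  cases h : χ i <;> simp [chiList, h]

theorem nodup_chiList {n : ℕ} (χ : Fin n → Face) : (chiList χ).Nodup := by
  refine List.Nodup.append ((List.nodup_finRange n).filter _)
    (List.nodup_reverse.2 ((List.nodup_finRange n).filter _)) ?_
  intro i h1 h2
  simp at h1 h2
  rw [h1] at h2
  exact Face.noConfusion h2

theorem length_chiList {n : ℕ} (χ : Fin n → Face) : n = (chiList χ).length := by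
  simpa using (Fintype.card_congr
    ((nodup_chiList χ).getEquivOfForallMemList _ (mem_chiList χ))).symm

/-- The permutation `s_χ`: if the left indices are `i₁ < ⋯ < i_p` and the right indices are
`i_{p+1} > ⋯ > i_n`, then `s_χ(j) = i_j`. The order `≺_χ` is `i₁ ≺ i₂ ≺ ⋯ ≺ i_n`. -/
def sPerm {n : ℕ} (χ : Fin n → Face) : Equiv.Perm (Fin n) :=
  (finCongr (length_chiList χ)).trans
    ((nodup_chiList χ).getEquivOfForallMemList _ (mem_chiList χ))

open Classical in
/-- The set `BNC(χ)` of bi-non-crossing partitions: those `π` with `s_χ⁻¹ · π` non-crossing. -/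
noncomputable def BNC {n : ℕ} (χ : Fin n → Face) : Finset (Partn n) :=
  Finset.univ.filter fun π => NonCrossing (π.permute (sPerm χ)⁻¹).parts

/-- `V` is a `χ`-interval, i.e. an interval for the total order
`i ≺_χ j ↔ s_χ⁻¹ i < s_χ⁻¹ j`. -/
def IsChiInterval {n : ℕ} (χ : Fin n → Face) (V : Finset (Fin n)) : Prop :=
  ∀ i ∈ V, ∀ k ∈ V, ∀ j : Fin n, (sPerm χ)⁻¹ i < (sPerm χ)⁻¹ j →
    (sPerm χ)⁻¹ j < (sPerm χ)⁻¹ k → j ∈ V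

open Classical in
/-- The set `BI(χ)` of bi-interval partitions. -/
noncomputable def BI {n : ℕ} (χ : Fin n → Face) : Finset (Partn n) :=
  (BNC χ).filter fun π => ∀ V ∈ π.parts, IsChiInterval χ V

/-- The bi-non-crossing Kreweras complement `K_BNC(π) = s_χ · K_NC(s_χ⁻¹ · π)`. -/
def krewerasBNC {n : ℕ} (χ : Fin n → Face) (π : Partn n) : Partn n :=
  (kreweras (π.permute (sPerm χ)⁻¹)).permute (sPerm χ)

/-! ### Cumulants -/

/-- The restriction `(a₁, …, aₙ)|_V = (a_{v₁}, …, a_{v_s})` for `V = {v₁ < ⋯ < v_s}`. -/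
def restr {T : Type*} {n : ℕ} (a : Fin n → T) (V : Finset (Fin n)) : Fin V.card → T :=
  fun i => a (V.orderEmbOfFin rfl i)

theorem card_lt_of_mem_parts {n : ℕ} {π : Partn n} (hπ : π ≠ ⊤) {V : Finset (Fin n)}
    (hV : V ∈ π.parts) : V.card < n := by
  by_contra hlt
  apply hπ
  have hVu : V = Finset.univ := by
    rw [← Finset.card_eq_iff_eq_univ]
    exact le_antisymm (Finset.card_le_univ V) (by simpa using hlt)
  subst hVu
  refine top_le_iff.1 fun W hW => ?_
  exact ⟨Finset.univ, hV, Finset.subset_univ _⟩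

section Cumulants

variable {A : Type*} [Ring A] [Algebra ℂ A]

/-- The cumulants `c_χ(a₁, …, aₙ)` of the linear functional `φ` attached to a family `L(χ)` of sets of
partitions, determined by `φ(a₁ ⋯ aₙ) = ∑_{π ∈ L(χ)} ∏_{V ∈ π} c_{χ|V}((a₁, …, aₙ)|_V)` for `n ≥ 1`
(see `moment_eq_sum_cumulant`): the recursion solves this formula for the term of the one-block
partition `⊤`. -/
noncomputable def cumulant (φ : A →ₗ[ℂ] ℂ) (L : ∀ {n : ℕ}, (Fin n → Face) → Finset (Partn n)) :
    (n : ℕ) → (Fin n → Face) → (Fin n → A) → ℂ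
  | n, χ, a => φ (List.ofFn a).prod -
      ∑ π ∈ ((L χ).filter fun π => π ≠ ⊤).attach, ∏ V ∈ π.1.parts.attach,
        cumulant φ L V.1.card (restr χ V.1) (restr a V.1)
  termination_by n => n
  decreasing_by exact card_lt_of_mem_parts (Finset.mem_filter.1 π.2).2 V.2

theorem restr_univ {T T' β : Type*} (F : ∀ n : ℕ, (Fin n → T) → (Fin n → T') → β) {n : ℕ}
    (χ : Fin n → T) (a : Fin n → T') :
    F (Finset.univ : Finset (Fin n)).card (restr χ Finset.univ) (restr a Finset.univ) = F n χ a := by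
  have key : ∀ (m : ℕ) (h : (Finset.univ : Finset (Fin n)).card = m),
      F m (fun i => χ (Finset.univ.orderEmbOfFin h i)) (fun i => a (Finset.univ.orderEmbOfFin h i)) =
        F n χ a := by
    intro m h
    obtain rfl : n = m := by simpa using h
    have hid : ∀ i, (Finset.univ : Finset (Fin n)).orderEmbOfFin h i = i := fun i =>
      (congrFun (Finset.orderEmbOfFin_unique h (f := id) (fun _ => Finset.mem_univ _)
        strictMono_id) i).symm
    simp only [hid]
  exact key _ rfl

theorem parts_top_of_pos {n : ℕ} (hn : 0 < n) : (⊤ : Partn n).parts = {Finset.univ} := by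
  have : Nonempty (Fin n) := ⟨⟨0, hn⟩⟩
  refine (Finset.subset_singleton_iff.1 (Finpartition.parts_top_subset _)).resolve_left ?_
  rw [Finpartition.parts_eq_empty_iff]
  exact Finset.univ_nonempty.ne_empty

/-- The sum over `L(χ)` with the term of the one-block partition split off. -/
theorem sum_parts_split {T T' : Type*} (F : ∀ n : ℕ, (Fin n → T) → (Fin n → T') → ℂ) {n : ℕ}
    (hn : 0 < n) (S : Finset (Partn n)) (hS : ⊤ ∈ S) (χ : Fin n → T) (a : Fin n → T') :
    ∑ π ∈ S, ∏ V ∈ π.parts, F V.card (restr χ V) (restr a V) =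
      F n χ a + ∑ π ∈ S.filter (fun π => π ≠ ⊤), ∏ V ∈ π.parts,
        F V.card (restr χ V) (restr a V) := by
  rw [Finset.filter_ne', ← Finset.add_sum_erase S _ hS, parts_top_of_pos hn, Finset.prod_singleton,
    restr_univ F]

theorem cumulant_eq (φ : A →ₗ[ℂ] ℂ) (L : ∀ {n : ℕ}, (Fin n → Face) → Finset (Partn n)) {n : ℕ}
    (χ : Fin n → Face) (a : Fin n → A) :
    cumulant φ L n χ a = φ (List.ofFn a).prod - ∑ π ∈ (L χ).filter (fun π => π ≠ ⊤),
      ∏ V ∈ π.parts, cumulant φ L V.card (restr χ V) (restr a V) := by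
  rw [cumulant, ← Finset.sum_attach (Finset.filter _ _)]
  congr 1
  refine Finset.sum_congr rfl fun π _ => ?_
  exact Finset.prod_attach π.1.parts
    (fun V => cumulant φ L V.card (restr χ V) (restr a V))

/-- The moment-cumulant formula. -/
theorem moment_eq_sum_cumulant (φ : A →ₗ[ℂ] ℂ)
    (L : ∀ {n : ℕ}, (Fin n → Face) → Finset (Partn n)) {n : ℕ} (hn : 0 < n)
    (χ : Fin n → Face) (hL : ⊤ ∈ L χ) (a : Fin n → A) :
    φ (List.ofFn a).prod =
      ∑ π ∈ L χ, ∏ V ∈ π.parts, cumulant φ L V.card (restr χ V) (restr a V) := by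
  rw [sum_parts_split (fun n χ a => cumulant φ L n χ a) hn (L χ) hL, cumulant_eq φ L χ a]
  ring

/-- The `(ℓ, r)`-cumulants `κ_χ(a₁, …, aₙ)`. -/
noncomputable def lrCumulant (φ : A →ₗ[ℂ] ℂ) (n : ℕ) (χ : Fin n → Face) (a : Fin n → A) : ℂ :=
  cumulant φ BNC n χ a

/-- The B-`(ℓ, r)`-cumulants `B_χ(a₁, …, aₙ)`. -/
noncomputable def bCumulant (φ : A →ₗ[ℂ] ℂ) (n : ℕ) (χ : Fin n → Face) (a : Fin n → A) : ℂ :=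
  cumulant φ BI n χ a

theorem top_mem_BNC {n : ℕ} (χ : Fin n → Face) : ⊤ ∈ BNC χ := by
  classical
  simp only [BNC, Finset.mem_filter, Finset.mem_univ, true_and]
  intro V hV W hW a b c d _ _ _ _ _ _ _
  simp only [Partn.permute, Finset.mem_map] at hV hW
  obtain ⟨V, hV, rfl⟩ := hV
  obtain ⟨W, hW, rfl⟩ := hW
  rw [Finpartition.parts_top_subsingleton _ hV hW]

theorem top_mem_BI {n : ℕ} (χ : Fin n → Face) : ⊤ ∈ BI χ := by
  classical
  simp only [BI, Finset.mem_filter, top_mem_BNC, true_and]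
  intro V hV i _ k _ j _ _
  have := Finset.mem_singleton.1 (Finpartition.parts_top_subset _ hV)
  rw [this]
  exact Finset.mem_univ _

end Cumulants

/-! ### Series in non-commuting indeterminates and the transforms -/

/-- A series with complex coefficients and vanishing constant term in the non-commuting
indeterminates `z_x`, `x : X`: `coeff n α` is the coefficient of `z_{α(1)} ⋯ z_{α(n)}`. -/
@[ext]
structure NCSeries (X : Type*) where
  coeff : (n : ℕ) → (Fin n → X) → ℂ
  coeff_zero : ∀ α : Fin 0 → X, coeff 0 α = 0

/-- `Cf_{(α(1), …, α(n)); π}(f) = ∏_{V ∈ π} Cf_{(α(1), …, α(n))|_V}(f)`. -/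
noncomputable def NCSeries.coeffPart {X : Type*} (f : NCSeries X) {n : ℕ} (α : Fin n → X)
    (π : Partn n) : ℂ :=
  ∏ V ∈ π.parts, f.coeff V.card (restr α V)

section TwoFaced

variable {I J : Type*}

/-- The map `χ_α`: elements of `I` are left, elements of `J` are right. -/
def chi {n : ℕ} (α : Fin n → I ⊕ J) : Fin n → Face :=
  fun k => Sum.elim (fun _ => Face.left) (fun _ => Face.right) (α k)

/-- The twisted boxed convolution. -/
noncomputable def NCSeries.twistedBox (f g : NCSeries (I ⊕ J)) : NCSeries (I ⊕ J) where
  coeff n α := if n = 0 then 0 else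
    ∑ π ∈ BNC (chi α), f.coeffPart α π * g.coeffPart α (krewerasBNC (chi α) π)
  coeff_zero _ := if_pos rfl

section

variable {A : Type*} [Ring A] [Algebra ℂ A]

/-- The bi-free `R`-transform of the two-faced family `a` with respect to `φ`. -/
noncomputable def rTransform (φ : A →ₗ[ℂ] ℂ) (a : I ⊕ J → A) : NCSeries (I ⊕ J) where
  coeff n α := if n = 0 then 0 else lrCumulant φ n (chi α) (fun k => a (α k))
  coeff_zero _ := if_pos rfl

/-- The bi-Boolean `η`-transform of the two-faced family `a` with respect to `φ`. -/
noncomputable def etaTransform (φ : A →ₗ[ℂ] ℂ) (a : I ⊕ J → A) : NCSeries (I ⊕ J) where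
  coeff n α := if n = 0 then 0 else bCumulant φ n (chi α) (fun k => a (α k))
  coeff_zero _ := if_pos rfl

end

variable (I J) in
/-- The set `D_alg(I ⊔ J)` of joint distributions: the unital linear functionals on the algebra
`ℂ⟨Z_k : k ∈ I ⊔ J⟩` of non-commutative polynomials. -/
def DAlg : Type _ := {μ : FreeAlgebra ℂ (I ⊕ J) →ₗ[ℂ] ℂ // μ 1 = 1}

/-- The map `R : D_alg(I ⊔ J) → ℂ₀⟨⟨z_k⟩⟩`. -/
noncomputable def rMap (μ : DAlg I J) : NCSeries (I ⊕ J) := rTransform μ.1 (FreeAlgebra.ι ℂ)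

/-- The map `η : D_alg(I ⊔ J) → ℂ₀⟨⟨z_k⟩⟩`. -/
noncomputable def etaMap (μ : DAlg I J) : NCSeries (I ⊕ J) := etaTransform μ.1 (FreeAlgebra.ι ℂ)

theorem basisFreeMonoid_ofFn {X : Type*} {n : ℕ} (α : Fin n → X) :
    FreeAlgebra.basisFreeMonoid ℂ X (FreeMonoid.ofList (List.ofFn α)) =
      (List.ofFn fun k => FreeAlgebra.ι ℂ (α k)).prod := by
  have h : FreeAlgebra.basisFreeMonoid ℂ X (FreeMonoid.ofList (List.ofFn α)) =
      FreeAlgebra.equivMonoidAlgebraFreeMonoid.symm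
        (MonoidAlgebra.single (FreeMonoid.ofList (List.ofFn α)) (1 : ℂ)) := by
    rfl
  rw [h]
  simp [FreeAlgebra.equivMonoidAlgebraFreeMonoid, FreeMonoid.lift_apply, List.map_ofFn,
    Function.comp_def]

/-- A unital functional on non-commutative polynomials is the same as a choice of moments. -/
theorem exists_moments (m : ∀ n : ℕ, (Fin n → I ⊕ J) → ℂ) :
    ∃ μ : DAlg I J, ∀ (n : ℕ) (_ : 0 < n) (α : Fin n → I ⊕ J),
      μ.1 (List.ofFn fun k => FreeAlgebra.ι ℂ (α k)).prod = m n α := by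
  classical
  let b := FreeAlgebra.basisFreeMonoid ℂ (I ⊕ J)
  let c : FreeMonoid (I ⊕ J) → ℂ := fun w =>
    if w.toList = [] then 1 else m w.toList.length w.toList.get
  have hb : ∀ w, b.constr ℂ c (b w) = c w := fun w => b.constr_basis ℂ c w
  refine ⟨⟨b.constr ℂ c, ?_⟩, fun n hn α => ?_⟩
  · have h : b (FreeMonoid.ofList []) = 1 :=
      (basisFreeMonoid_ofFn (X := I ⊕ J) (n := 0) Fin.elim0).trans (by simp)
    rw [← h, hb]
    exact if_pos rfl
  · change b.constr ℂ c _ = _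
    rw [← basisFreeMonoid_ofFn, hb]
    have hne : List.ofFn α ≠ [] := by
      rw [Ne, List.ofFn_eq_nil_iff]; omega
    have h := List.equivSigmaTuple.apply_symm_apply (⟨n, α⟩ : Σ n, Fin n → I ⊕ J)
    exact (if_neg hne).trans (congrArg (fun s : Σ n, Fin n → I ⊕ J => m s.1 s.2) h)

theorem DAlg_ext {μ ν : DAlg I J} (h : ∀ (n : ℕ) (_ : 0 < n) (α : Fin n → I ⊕ J),
    μ.1 (List.ofFn fun k => FreeAlgebra.ι ℂ (α k)).prod =
      ν.1 (List.ofFn fun k => FreeAlgebra.ι ℂ (α k)).prod) : μ = ν := by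
  apply Subtype.ext
  refine (FreeAlgebra.basisFreeMonoid ℂ (I ⊕ J)).ext fun w => ?_
  obtain ⟨n, α, hw⟩ := List.exists_iff_exists_tuple.1 ⟨w.toList, rfl⟩
  have hw' : w = FreeMonoid.ofList (List.ofFn α) := by rw [← hw]; rfl
  rw [hw', basisFreeMonoid_ofFn]
  rcases Nat.eq_zero_or_pos n with rfl | hn
  · simp [μ.2, ν.2]
  · exact h n hn α

/-- Passing from unital functionals to the series of their cumulants is bijective. -/
theorem cumulantMap_bijective (L : ∀ {n : ℕ}, (Fin n → Face) → Finset (Partn n))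
    (hL : ∀ {n : ℕ} (χ : Fin n → Face), ⊤ ∈ L χ) (T : DAlg I J → NCSeries (I ⊕ J))
    (hT : ∀ μ (n : ℕ) (α : Fin n → I ⊕ J), 0 < n →
      (T μ).coeff n α = cumulant μ.1 L n (chi α) (fun k => FreeAlgebra.ι ℂ (α k))) :
    Function.Bijective T := by
  constructor
  · intro μ ν h
    refine DAlg_ext fun n hn α => ?_
    rw [moment_eq_sum_cumulant _ L hn (chi α) (hL _), moment_eq_sum_cumulant _ L hn (chi α) (hL _)]
    refine Finset.sum_congr rfl fun π _ => Finset.prod_congr rfl fun V hV => ?_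
    have hV0 : 0 < V.card := Finset.card_pos.2 (π.nonempty_of_mem_parts hV)
    have h1 := hT μ V.card (restr α V) hV0
    rw [h, hT ν V.card (restr α V) hV0] at h1
    exact h1.symm
  · intro f
    obtain ⟨μ, hμ⟩ := exists_moments (I := I) (J := J)
      (fun n α => ∑ π ∈ L (chi α), f.coeffPart α π)
    refine ⟨μ, ?_⟩
    have key : ∀ n : ℕ, 0 < n → ∀ α : Fin n → I ⊕ J,
        cumulant μ.1 L n (chi α) (fun k => FreeAlgebra.ι ℂ (α k)) = f.coeff n α := by
      intro n
      induction n using Nat.strong_induction_on with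
      | _ n ih =>
        intro hn α
        have h1 := hμ n hn α
        have h2 := sum_parts_split (fun n (_ : Fin n → Face) α => f.coeff n α) hn (L (chi α))
          (hL _) (chi α) α
        simp only [NCSeries.coeffPart] at h1
        rw [h2] at h1
        rw [cumulant_eq, h1, add_sub_assoc, add_eq_left, sub_eq_zero]
        refine Finset.sum_congr rfl fun π hπ => Finset.prod_congr rfl fun V hV => ?_
        exact (ih V.card (card_lt_of_mem_parts (Finset.mem_filter.1 hπ).2 hV)
          (Finset.card_pos.2 (π.nonempty_of_mem_parts hV)) (restr α V)).symm
    ext n α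
    rcases Nat.eq_zero_or_pos n with rfl | hn
    · rw [NCSeries.coeff_zero, NCSeries.coeff_zero]
    · rw [hT μ n α hn, key n hn α]

theorem rMap_bijective : Function.Bijective (rMap : DAlg I J → NCSeries (I ⊕ J)) :=
  cumulantMap_bijective BNC top_mem_BNC rMap fun _ _ _ hn => if_neg hn.ne'

theorem etaMap_bijective : Function.Bijective (etaMap : DAlg I J → NCSeries (I ⊕ J)) :=
  cumulantMap_bijective BI top_mem_BI etaMap fun _ _ _ hn => if_neg hn.ne'

/-- The bijection `bReta = η ∘ R⁻¹`. -/
noncomputable def bReta : NCSeries (I ⊕ J) ≃ NCSeries (I ⊕ J) :=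
  (Equiv.ofBijective rMap rMap_bijective).symm.trans (Equiv.ofBijective etaMap etaMap_bijective)

end TwoFaced

/-! ### Functions on non-empty words

A function on non-empty words over `X` is written `φ x t`, for the word `x :: t`. -/

/-! The order `≺` restricts to the corresponding order on every subset of positions, and a
coefficient of a series depends only on the set of positions it is read from. So, once `α` is fixed,
a series becomes a function `F` on words of positions, only its values at `≺`-increasing words
matter, and bi-non-crossing partitions become ordinary non-crossing ones. What remains is an
identity about functions on words, proved in the algebra of the overlapping product `conv` and the
substitution `F[L] = subst F L`, with unit `one` and with `N = two`.

Draw a non-crossing partition and its Kreweras complement together on alternating odd points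
(letters) and even points (gaps). Summing over all such pictures, with blocks of letters weighted by
`F` and blocks of gaps by `G`, let `P` collect those that begin and end at a letter and `Q` those
that begin and end at a gap. Decomposing along the block of the left end point gives `P = F[Q N]`
and `Q = G[N P]`, and the boxed convolution is `box F G = P Q` (`planarSum_eq_subst`,
`sum_noncrossing_eq_box`).

For `G = zeta` this is the moment function `M` of `F`. Since `zeta[L] = 1 + L zeta[L]`, it satisfies
`M = H + H N M` with `H = P`. Sums over interval partitions satisfy the same recursion, which
determines `H` from `M` (`eq_of_moments`), so `H = booleanize F` is the word form of `bReta`.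
Moreover `H = F[E]` with `E = N + N H E`.

Multiplicativity (`booleanize_box`) then follows from associativity of substitution. Let `p, q` be
the planar pair of `booleanize F` and `booleanize G`. Let `p', q'` be the planar pair of `F` and `G`
after substituting the series `C` for which `booleanize (box F G) = (box F G)[C]`. Both pairs solve
one system of equations in `F` and `G`, which has a unique solution by induction on word length
(`planar_unique`). Hence `box (booleanize F) (booleanize G) = p q = p' q' = booleanize (box F G)`.
-/

/-- Complex functions on non-empty words: `φ x t` is the value at `x :: t`. -/
abbrev WordFn (X : Type*) : Type _ := X → List X → ℂ

namespace WordFn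

variable {X : Type*}

/-- Prefixing a letter. -/
def shift (x : X) (φ : WordFn X) : WordFn X := fun y r => φ x (y :: r)

/-- The overlapping product `(φ ψ)(x₁ ⋯ xₙ) = ∑ₘ φ(x₁ ⋯ xₘ) ψ(xₘ ⋯ xₙ)`. -/
def conv (φ ψ : WordFn X) : WordFn X := fun x t =>
  match t with
  | [] => φ x [] * ψ x []
  | y :: r => φ x [] * ψ x (y :: r) + conv (shift x φ) ψ y r

/-- The product `κ · φ[L]`, see `convSubst_eq`. -/
def convSubst (L κ φ : WordFn X) : WordFn X := fun x t =>
  match t with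
  | [] => κ x [] * φ x []
  | y :: r => κ x [] * convSubst L (shift x L) (shift x φ) y r + convSubst L (shift x κ) φ y r

/-- The substitution
`φ[L](x₁ ⋯ xₙ) = ∑ φ(x_{v₁} ⋯ x_{vₖ}) ∏ L(x_{vᵢ} ⋯ x_{vᵢ₊₁})` over `1 = v₁ < ⋯ < vₖ = n`. -/
def subst (φ L : WordFn X) : WordFn X := fun x t =>
  match t with
  | [] => φ x []
  | y :: r => convSubst L (shift x L) (shift x φ) y r

/-- The indicator of one-letter words, the unit of `conv`. -/
def one : WordFn X := fun _ t => if t = [] then 1 else 0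

/-- The indicator of two-letter words. -/
def two : WordFn X := fun _ t => if t.length = 1 then 1 else 0

/-- The constant function `1`. -/
def zeta : WordFn X := fun _ _ => 1

/-! ### The algebra of the overlapping product -/

theorem conv_nil (φ ψ : WordFn X) (x : X) : conv φ ψ x [] = φ x [] * ψ x [] := rfl

theorem conv_cons (φ ψ : WordFn X) (x y : X) (r : List X) :
    conv φ ψ x (y :: r) = φ x [] * ψ x (y :: r) + conv (shift x φ) ψ y r := rfl

/-- The overlap point is either the prefixed letter itself or a later one. This twisted Leibniz rule
drives the inductions on words. -/
theorem shift_conv (φ ψ : WordFn X) (x : X) :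
    shift x (conv φ ψ) = φ x [] • shift x ψ + conv (shift x φ) ψ := rfl

theorem conv_add_left (φ φ' ψ : WordFn X) : conv (φ + φ') ψ = conv φ ψ + conv φ' ψ := by
  funext x t
  induction t generalizing φ φ' x with
  | nil => simp [conv_nil, add_mul]
  | cons y r ih =>
    have := ih (shift x φ) (shift x φ') y
    simp only [Pi.add_apply, conv_cons] at this ⊢
    rw [show shift x (φ + φ') = shift x φ + shift x φ' from rfl, this]
    ring

theorem conv_add_right (φ ψ ψ' : WordFn X) : conv φ (ψ + ψ') = conv φ ψ + conv φ ψ' := by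
  funext x t
  induction t generalizing φ x with
  | nil => simp [conv_nil, mul_add]
  | cons y r ih =>
    have := ih (shift x φ) y
    simp only [Pi.add_apply, conv_cons] at this ⊢
    rw [this]
    ring

theorem conv_smul_left (c : ℂ) (φ ψ : WordFn X) : conv (c • φ) ψ = c • conv φ ψ := by
  funext x t
  induction t generalizing φ x with
  | nil => simp [conv_nil, mul_assoc]
  | cons y r ih =>
    have := ih (shift x φ) y
    simp only [Pi.smul_apply, smul_eq_mul, conv_cons] at this ⊢
    rw [show shift x (c • φ) = c • shift x φ from rfl, this]
    ring

theorem conv_smul_right (c : ℂ) (φ ψ : WordFn X) : conv φ (c • ψ) = c • conv φ ψ := by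
  funext x t
  induction t generalizing φ x with
  | nil => simp [conv_nil, mul_left_comm]
  | cons y r ih =>
    have := ih (shift x φ) y
    simp only [Pi.smul_apply, smul_eq_mul, conv_cons] at this ⊢
    rw [this]
    ring

theorem zero_conv (ψ : WordFn X) : conv 0 ψ = 0 := by
  simpa using conv_smul_left 0 0 ψ

theorem conv_assoc (φ ψ χ : WordFn X) : conv (conv φ ψ) χ = conv φ (conv ψ χ) := by
  funext x t
  induction t generalizing φ x with
  | nil => simp [conv_nil, mul_assoc]
  | cons y r ih =>
    have := ih (shift x φ) y
    simp only [conv_cons] at this ⊢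
    rw [shift_conv, conv_add_left, conv_smul_left, Pi.add_apply, Pi.add_apply, this, conv_nil]
    simp only [Pi.smul_apply, smul_eq_mul]
    ring

theorem shift_one (x : X) : shift x one = 0 := by
  funext y r
  simp [shift, one]

theorem shift_two (x : X) : shift x two = one := by
  funext y r
  simp [shift, one, two]

theorem one_conv (ψ : WordFn X) : conv one ψ = ψ := by
  funext x t
  cases t with
  | nil => simp [conv_nil, one]
  | cons y r => rw [conv_cons, shift_one, zero_conv]; simp [one]

theorem conv_one (φ : WordFn X) : conv φ one = φ := by
  funext x t
  induction t generalizing φ x with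
  | nil => simp [conv_nil, one]
  | cons y r ih => rw [conv_cons, ih]; simp [one, shift]

/-- Left multiplication by `two` merely skips the first letter; this is how equations gain one
degree. -/
theorem shift_two_conv (ψ : WordFn X) (x : X) : shift x (conv two ψ) = ψ := by
  rw [shift_conv, shift_two, one_conv]
  simp [two]

theorem two_conv_nil (ψ : WordFn X) (x : X) : conv two ψ x [] = 0 := by
  simp [conv_nil, two]

theorem conv_nil_eq_zero {ψ : WordFn X} (hψ : ∀ x, ψ x [] = 0) (φ : WordFn X) (x : X) :
    conv φ ψ x [] = 0 := by
  simp [conv_nil, hψ]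

/-- A direct recursion for `subst` would call it on every suffix of the tail. Carrying the left
factor `κ` along makes the recursion structural, and this identity removes the auxiliary function
again. -/
theorem convSubst_eq (L κ φ : WordFn X) : convSubst L κ φ = conv κ (subst φ L) := by
  funext x t
  induction t generalizing κ x with
  | nil => rfl
  | cons y r ih => rw [conv_cons, ← ih]; rfl

theorem subst_nil (φ L : WordFn X) (x : X) : subst φ L x [] = φ x [] := rfl

/-- The first factor `L` covers the stretch up to the second marked letter; the rest is a
substitution into `φ` with its first letter fixed. -/
theorem shift_subst (φ L : WordFn X) (x : X) :
    shift x (subst φ L) = conv (shift x L) (subst (shift x φ) L) := by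
  rw [← convSubst_eq]; rfl

theorem subst_cons (φ L : WordFn X) (x y : X) (r : List X) :
    subst φ L x (y :: r) = conv (shift x L) (subst (shift x φ) L) y r := by
  rw [← convSubst_eq]; rfl

/-! ### Agreement up to a given length -/

/-- Agreement on all words of length at most `n`. -/
def Agree (n : ℕ) (φ ψ : WordFn X) : Prop := ∀ x t, t.length < n → φ x t = ψ x t

/-- Since `subst_cons` involves all suffixes of the tail, structural induction on the word is too
weak; identities for `subst` are proved by induction on a length bound. -/
theorem eq_of_agree {φ ψ : WordFn X} (h : ∀ n, Agree n φ ψ) : φ = ψ := by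
  funext x t
  exact h _ x t (Nat.lt_succ_self _)

theorem Agree.refl (n : ℕ) (φ : WordFn X) : Agree n φ φ := fun _ _ _ => rfl

theorem Agree.add {n : ℕ} {φ φ' ψ ψ' : WordFn X} (h : Agree n φ φ') (h' : Agree n ψ ψ') :
    Agree n (φ + ψ) (φ' + ψ') := fun x t ht =>
  congrArg₂ (· + ·) (h x t ht) (h' x t ht)

theorem Agree.shift {n : ℕ} {φ φ' : WordFn X} (h : Agree (n + 1) φ φ') (x : X) :
    Agree n (shift x φ) (shift x φ') := fun y r hr => h x (y :: r) (by simpa using hr)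

theorem Agree.mono {m n : ℕ} (hmn : m ≤ n) {φ φ' : WordFn X} (h : Agree n φ φ') :
    Agree m φ φ' := fun x t ht => h x t (ht.trans_le hmn)

theorem Agree.conv {n : ℕ} {φ φ' ψ ψ' : WordFn X} (h : Agree n φ φ') (h' : Agree n ψ ψ') :
    Agree n (conv φ ψ) (conv φ' ψ') := by
  intro x t ht
  induction t generalizing n φ φ' x with
  | nil => rw [conv_nil, conv_nil, h x [] ht, h' x [] ht]
  | cons y r ih =>
    obtain ⟨n, rfl⟩ : ∃ m, n = m + 1 := ⟨n - 1, by simp at ht; omega⟩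
    rw [conv_cons, conv_cons, h x [] (by simp), h' x _ ht,
      ih (h.shift x) (h'.mono n.le_succ) y (by simpa using ht)]

/-- The gain of one letter here makes the planar fixed-point equations contracting. -/
theorem Agree.two_conv {n : ℕ} {ψ ψ' : WordFn X} (h : Agree n ψ ψ') :
    Agree (n + 1) (WordFn.conv two ψ) (WordFn.conv two ψ') := by
  intro x t ht
  cases t with
  | nil => rw [two_conv_nil, two_conv_nil]
  | cons y r =>
    have := h y r (by simpa using ht)
    rwa [← shift_two_conv ψ x, ← shift_two_conv ψ' x] at this

/-- If the right factors vanish on letters, the left factors matter only on shorter words. -/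
theorem Agree.conv_of_nil {n : ℕ} {φ φ' ψ ψ' : WordFn X} (h : Agree n φ φ')
    (h' : Agree (n + 1) ψ ψ') (hψ : ∀ x, ψ x [] = 0) (hψ' : ∀ x, ψ' x [] = 0) :
    Agree (n + 1) (WordFn.conv φ ψ) (WordFn.conv φ' ψ') := by
  intro x t ht
  induction t generalizing n φ φ' x with
  | nil => rw [conv_nil, conv_nil, hψ, hψ', mul_zero, mul_zero]
  | cons y r ih =>
    obtain ⟨n, rfl⟩ : ∃ m, n = m + 1 := ⟨n - 1, by simp at ht; omega⟩
    rw [conv_cons, conv_cons, h x [] (by simp), h' x _ ht,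
      ih (h.shift x) (h'.mono (by omega)) y (by simpa using ht)]

theorem Agree.subst {n : ℕ} (φ : WordFn X) {L L' : WordFn X} (h : Agree n L L') :
    Agree n (subst φ L) (subst φ L') := by
  induction n generalizing φ with
  | zero => intro x t ht; simp at ht
  | succ n ih =>
    intro x t ht
    cases t with
    | nil => rfl
    | cons y r =>
      rw [subst_cons, subst_cons]
      exact (h.shift x).conv (ih _ (h.mono n.le_succ)) y r (by simpa using ht)

/-! ### Substitution as a homomorphism -/

theorem subst_add (φ ψ L : WordFn X) : subst (φ + ψ) L = subst φ L + subst ψ L := by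
  refine eq_of_agree fun n => ?_
  induction n generalizing φ ψ with
  | zero => intro x t ht; simp at ht
  | succ n ih =>
    intro x t ht
    cases t with
    | nil => rfl
    | cons y r =>
      rw [Pi.add_apply, Pi.add_apply, subst_cons, subst_cons, subst_cons]
      have := (Agree.refl n (shift x L)).conv (ih (shift x φ) (shift x ψ)) y r (by simpa using ht)
      rw [show shift x (φ + ψ) = shift x φ + shift x ψ from rfl, this, conv_add_right]
      rfl

theorem subst_smul (c : ℂ) (φ L : WordFn X) : subst (c • φ) L = c • subst φ L := by
  refine eq_of_agree fun n => ?_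
  induction n generalizing φ with
  | zero => intro x t ht; simp at ht
  | succ n ih =>
    intro x t ht
    cases t with
    | nil => rfl
    | cons y r =>
      rw [Pi.smul_apply, Pi.smul_apply, subst_cons, subst_cons]
      have := (Agree.refl n (shift x L)).conv (ih (shift x φ)) y r (by simpa using ht)
      rw [show shift x (c • φ) = c • shift x φ from rfl, this, conv_smul_right]
      rfl

/-- Substitution is multiplicative. -/
theorem subst_conv (φ ψ L : WordFn X) :
    subst (conv φ ψ) L = conv (subst φ L) (subst ψ L) := by
  refine eq_of_agree fun n => ?_
  induction n generalizing φ with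
  | zero => intro x t ht; simp at ht
  | succ n ih =>
    intro x t ht
    cases t with
    | nil => rfl
    | cons y r =>
      have := (Agree.refl n (shift x L)).conv (ih (shift x φ)) y r (by simpa using ht)
      -- After the Leibniz rule, associativity regroups `shift x L` with the substituted `shift x
      -- φ`, and `shift_subst` folds them back into `shift x (subst φ L)`.
      rw [subst_cons, shift_conv, subst_add, subst_smul, conv_add_right, conv_smul_right,
        Pi.add_apply, Pi.add_apply, this, ← conv_assoc, ← shift_subst φ, conv_cons, subst_nil,
        subst_cons]
      rfl

/-- Associativity follows from multiplicativity: the stretch before the second letter marked by the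
outer substitution is itself a substitution into `K`. -/
theorem subst_subst (φ K L : WordFn X) : subst (subst φ K) L = subst φ (subst K L) := by
  refine eq_of_agree fun n => ?_
  induction n generalizing φ with
  | zero => intro x t ht; simp at ht
  | succ n ih =>
    intro x t ht
    cases t with
    | nil => rfl
    | cons y r =>
      have := (Agree.refl n (conv (shift x L) (subst (shift x K) L))).conv (ih (shift x φ)) y r
        (by simpa using ht)
      rw [subst_cons, shift_subst, subst_conv, ← conv_assoc, this, ← shift_subst, ← subst_cons]

theorem subst_one (L : WordFn X) : subst one L = one := by
  funext x t
  cases t with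
  | nil => rfl
  | cons y r =>
    have h : subst (0 : WordFn X) L = 0 := by simpa using subst_smul 0 0 L
    have h' : conv (shift x L) 0 = 0 := by simpa using conv_smul_right 0 (shift x L) 0
    rw [subst_cons, shift_one, h, h']
    simp [one]

/-- The condition on letters is needed because a substitution never reads `L` on one-letter words.
-/
theorem subst_two {L : WordFn X} (hL : ∀ x, L x [] = 0) : subst two L = L := by
  funext x t
  cases t with
  | nil => rw [subst_nil, hL]; rfl
  | cons y r => rw [subst_cons, shift_two, subst_one, conv_one]; rfl

theorem subst_two_right (φ : WordFn X) : subst φ two = φ := by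
  refine eq_of_agree fun n => ?_
  induction n generalizing φ with
  | zero => intro x t ht; simp at ht
  | succ n ih =>
    intro x t ht
    cases t with
    | nil => rfl
    | cons y r =>
      rw [subst_cons, shift_two, one_conv]
      exact ih _ y r (by simpa using ht)

/-- `zeta` is the geometric series in `two`, so that `subst zeta L` becomes the geometric series in
`L`. -/
theorem zeta_eq : (zeta : WordFn X) = one + conv two zeta := by
  funext x t
  cases t with
  | nil => simp [zeta, one, two_conv_nil]
  | cons y r =>
    have := congrFun (congrFun (shift_two_conv (zeta : WordFn X) x) y) r
    change conv two zeta x (y :: r) = _ at this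
    simp [this, one, zeta]

theorem subst_zeta {L : WordFn X} (hL : ∀ x, L x [] = 0) :
    subst zeta L = one + conv L (subst zeta L) := by
  conv_lhs => rw [zeta_eq, subst_add, subst_conv, subst_one, subst_two hL]

/-! ### The planar pair of two word functions -/

/-- Iteration towards the fixed point `P = F[G[N P] N]`. -/
noncomputable def planarIter (F G : WordFn X) : ℕ → WordFn X
  | 0 => 0
  | n + 1 => subst F (conv (subst G (conv two (planarIter F G n))) two)

/-- The solution of `P = F[Q N]`, `Q = G[N P]`, first component. -/
noncomputable def planarFst (F G : WordFn X) : WordFn X := fun x t =>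
  planarIter F G (t.length + 1) x t

/-- The solution of `P = F[Q N]`, `Q = G[N P]`, second component. -/
noncomputable def planarSnd (F G : WordFn X) : WordFn X := subst G (conv two (planarFst F G))

theorem two_nil (x : X) : (two : WordFn X) x [] = 0 := rfl

/-- Of the two factors `two`, the one in front of `P` already provides the extra letter. -/
theorem Agree.planarStep {n : ℕ} (F G : WordFn X) {P P' : WordFn X} (h : Agree n P P') :
    Agree (n + 1) (WordFn.subst F (WordFn.conv (WordFn.subst G (WordFn.conv two P)) two))
      (WordFn.subst F (WordFn.conv (WordFn.subst G (WordFn.conv two P')) two)) :=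
  ((Agree.subst G h.two_conv).conv (Agree.refl _ _)).subst F

/-- The iterates stabilize on words of length at most `m` from the `m`-th on, which justifies the
diagonal choice in `planarFst`. -/
theorem planarIter_agree (F G : WordFn X) {m n : ℕ} (h : m ≤ n) :
    Agree m (planarIter F G m) (planarIter F G n) := by
  induction m generalizing n with
  | zero => intro x t ht; simp at ht
  | succ m ih =>
    obtain ⟨n, rfl⟩ : ∃ k, n = k + 1 := ⟨n - 1, by omega⟩
    exact (ih (by omega)).planarStep F G

theorem planarFst_eq (F G : WordFn X) :
    planarFst F G = subst F (conv (planarSnd F G) two) := by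
  refine eq_of_agree fun n => ?_
  have h : ∀ m, Agree m (planarFst F G) (planarIter F G m) := fun m x t ht =>
    planarIter_agree F G ht x t (Nat.lt_succ_self _)
  have h1 := (h n).planarStep F G
  intro x t ht
  exact (h (n + 1) x t (by omega)).trans (h1 x t (by omega)).symm

/-- The word version of the boxed convolution. -/
noncomputable def box (F G : WordFn X) : WordFn X := conv (planarFst F G) (planarSnd F G)

/-- The word version of the map `f ↦ bReta(f)`. -/
noncomputable def booleanize (F : WordFn X) : WordFn X := planarFst F zeta

theorem planarSnd_zeta (F : WordFn X) :
    planarSnd F zeta = one + conv (conv two (booleanize F)) (planarSnd F zeta) :=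
  subst_zeta (two_conv_nil _)

/-- Splitting off the first factor of a moment. -/
theorem box_zeta (F : WordFn X) :
    box F zeta = booleanize F + conv (booleanize F) (conv two (box F zeta)) := by
  have h := congrArg (conv (booleanize F)) (planarSnd_zeta F)
  rw [conv_add_right, conv_one, conv_assoc two] at h
  exact h

/-! ### Uniqueness and multiplicativity -/

/-- All four unknowns are compared at once by induction on length. The factors `two` give `A` and
`B` one more letter than the induction hypothesis provides, and `p`, `q` inherit it through
substitution. -/
theorem planar_unique {F G p q A B p' q' A' B' : WordFn X}
    (hp : p = subst F A) (hq : q = subst G B)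
    (hA : A = conv q (two + conv two (conv p A))) (hB : B = conv two (p + conv p (conv q B)))
    (hp' : p' = subst F A') (hq' : q' = subst G B')
    (hA' : A' = conv q' (two + conv two (conv p' A')))
    (hB' : B' = conv two (p' + conv p' (conv q' B'))) : p = p' ∧ q = q' := by
  have key : ∀ n, Agree n p p' ∧ Agree n q q' ∧ Agree n A A' ∧ Agree n B B' := by
    intro n
    induction n with
    | zero => refine ⟨?_, ?_, ?_, ?_⟩ <;> · intro x t ht; simp at ht
    | succ n ih =>
      obtain ⟨h1, h2, h3, h4⟩ := ih
      have a : Agree (n + 1) A A' := by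
        rw [hA, hA']
        -- Here `q` stands in front, so agreement of `q` up to `n` suffices only because the right
        -- factor vanishes on single letters.
        refine h2.conv_of_nil ((Agree.refl _ _).add (h1.conv h3).two_conv) ?_ ?_ <;>
        · intro x
          simp [two_nil, two_conv_nil]
      have b : Agree (n + 1) B B' := by
        rw [hB, hB']
        exact (h1.add (h1.conv (h2.conv h4))).two_conv
      refine ⟨?_, ?_, a, b⟩
      · rw [hp, hp']; exact a.subst F
      · rw [hq, hq']; exact b.subst G
  exact ⟨eq_of_agree fun n => (key n).1, eq_of_agree fun n => (key n).2.1⟩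

/-- `H = F[E]` and `E = N + N H E` for `H = booleanize F`. -/
theorem exists_booleanize_eq (F : WordFn X) :
    ∃ E : WordFn X, booleanize F = subst F E ∧
      E = two + conv two (conv (booleanize F) E) := by
  refine ⟨conv (planarSnd F zeta) two, planarFst_eq F zeta, ?_⟩
  conv_lhs => rw [planarSnd_zeta]
  rw [conv_add_left, one_conv, conv_assoc, conv_assoc]

/-- `booleanize` is multiplicative for the boxed convolution. -/
theorem booleanize_box (F G : WordFn X) :
    booleanize (box F G) = box (booleanize F) (booleanize G) := by
  obtain ⟨E, hFE, hE⟩ := exists_booleanize_eq F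
  obtain ⟨D, hGD, hD⟩ := exists_booleanize_eq G
  obtain ⟨C, hC', hC⟩ := exists_booleanize_eq (box F G)
  set p := planarFst (booleanize F) (booleanize G) with hp
  set q := planarSnd (booleanize F) (booleanize G) with hq
  have hpF : p = subst (booleanize F) (conv q two) := planarFst_eq _ _
  have hqG : q = subst (booleanize G) (conv two p) := rfl
  have h2 : subst two (conv q two) = conv q two := subst_two (conv_nil_eq_zero two_nil _)
  have h2' : subst two (conv two p) = conv two p := subst_two (two_conv_nil _)
  set p' := subst (planarFst F G) C with hp'
  set q' := subst (planarSnd F G) C with hq'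
  have hbox : booleanize (box F G) = conv p' q' := by rw [hC', box, subst_conv]
  have h2C : subst two C = C := subst_two fun x => by
    rw [hC]; simp [two_nil, two_conv_nil]
  have key := planar_unique (F := F) (G := G) (p := p) (q := q) (p' := p') (q' := q')
    (A := subst E (conv q two)) (B := subst D (conv two p)) (A' := conv q' C) (B' := conv C p')
    ?_ ?_ ?_ ?_ ?_ ?_ ?_ ?_
  · rw [hbox, ← key.1, ← key.2, box]
  · rw [← subst_subst, ← hFE, ← hpF]
  · rw [← subst_subst, ← hGD, ← hqG]
  -- Substituting `q N` into `E = N + N H E`, where `H` is `booleanize F`, turns `H` into `p` and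
  -- yields the equation for `A`.
  · have h := congrArg (fun φ => subst φ (conv q two)) hE
    simp only [subst_add, subst_conv, h2, ← hpF] at h
    rw [conv_add_right, ← conv_assoc q two]
    exact h
  · have h := congrArg (fun φ => subst φ (conv two p)) hD
    simp only [subst_add, subst_conv, h2', ← hqG] at h
    rw [conv_add_right, ← conv_assoc two p]
    exact h
  · rw [hp', hq', planarFst_eq, subst_subst, subst_conv, h2C]
  · rw [hp', hq', planarSnd, subst_subst, subst_conv, h2C]
  -- For the second solution, multiply `C = N + N p' q' C` by `q'` on the left; the last case
  -- multiplies it by `p'` on the right.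
  · rw [hbox] at hC
    conv_lhs => rw [hC]
    rw [conv_assoc p']
  · rw [hbox] at hC
    conv_lhs => rw [hC]
    rw [conv_add_left, conv_assoc two, conv_assoc (conv p' q'), conv_assoc p', ← conv_add_right]

end WordFn

/-! ### Planar partitions of alternating intervals -/

/-- The partitions `R` of the integer interval `[a, b]` which are non-crossing with blocks of
constant parity, and such that the odd blocks and the even blocks are complementary: two points are
in one block as soon as no block of the other parity separates them. -/
structure IsPlanar (a b : ℕ) (R : Finset (Finset ℕ)) : Prop where
  nonempty : ∀ V ∈ R, V.Nonempty
  bounds : ∀ V ∈ R, ∀ x ∈ V, a ≤ x ∧ x ≤ b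
  cover : ∀ x, a ≤ x → x ≤ b → ∃ V ∈ R, x ∈ V
  eq_of_mem : ∀ V ∈ R, ∀ W ∈ R, ∀ x, x ∈ V → x ∈ W → V = W
  parity : ∀ V ∈ R, ∀ x ∈ V, ∀ y ∈ V, x % 2 = y % 2
  noncross : ∀ V ∈ R, ∀ W ∈ R, ∀ x ∈ V, ∀ y ∈ V, ∀ u ∈ W, ∀ v ∈ W, u % 2 ≠ x % 2 →
    x < u → u < y → x < v ∧ v < y
  maximal : ∀ x y, a ≤ x → x < y → y ≤ b → x % 2 = y % 2 →
    (∀ W ∈ R, ∀ u ∈ W, ∀ v ∈ W, u % 2 ≠ x % 2 → x < u → u < y → x < v ∧ v < y) →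
    ∃ V ∈ R, x ∈ V ∧ y ∈ V

namespace IsPlanar

variable {a b m : ℕ} {R : Finset (Finset ℕ)}

/-- For equal parities, suppose two different blocks cross at `x < u < y < v`. By maximality some
block of the other parity separates `x` from `u`. It cannot cross `V`, so it has a point between `u`
and `y`; then it crosses `W`. -/
theorem not_cross (h : IsPlanar a b R) {V W : Finset ℕ} (hV : V ∈ R) (hW : W ∈ R) {x y u v : ℕ}
    (hx : x ∈ V) (hy : y ∈ V) (hu : u ∈ W) (hv : v ∈ W) (h1 : x < u) (h2 : u < y) (h3 : y < v) :
    V = W := by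
  by_cases hp : u % 2 = x % 2
  · by_contra hne
    have hs : ¬ ∀ Z ∈ R, ∀ s ∈ Z, ∀ t ∈ Z, s % 2 ≠ x % 2 → x < s → s < u → x < t ∧ t < u := by
      intro hs
      obtain ⟨Z, hZ, hxZ, huZ⟩ := h.maximal x u (h.bounds V hV x hx).1 h1 (h.bounds W hW u hu).2
        hp.symm hs
      exact hne ((h.eq_of_mem V hV Z hZ x hx hxZ).trans (h.eq_of_mem W hW Z hZ u hu huZ).symm)
    push Not at hs
    obtain ⟨Z, hZ, s, hs, t, ht, hsp, hxs, hsu, hst⟩ := hs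
    have e1 := h.noncross V hV Z hZ x hx y hy s hs t ht hsp hxs (by omega)
    have e2 := h.parity Z hZ s hs t ht
    have e3 := hst e1.1
    have e4 := h.noncross W hW Z hZ u hu v hv t ht s hs (by omega) (by omega) (by omega)
    omega
  · have := h.noncross V hV W hW x hx y hy u hu v hv hp h1 h2
    omega

theorem between (h : IsPlanar a b R) {V W : Finset ℕ} (hV : V ∈ R) (hW : W ∈ R) (hne : V ≠ W)
    {x y u v : ℕ} (hx : x ∈ V) (hy : y ∈ V) (hu : u ∈ W) (hv : v ∈ W) (h1 : x < u) (h2 : u < y) :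
    x < v ∧ v < y := by
  have hvx : v ≠ x := fun e => hne (h.eq_of_mem V hV W hW x hx (e ▸ hv))
  have hvy : v ≠ y := fun e => hne (h.eq_of_mem V hV W hW y hy (e ▸ hv))
  refine ⟨?_, ?_⟩
  · by_contra hc
    exact hne (h.not_cross hW hV hv hu hx hy (by omega) h1 h2).symm
  · by_contra hc
    exact hne (h.not_cross hV hW hx hy hu hv h1 h2 (by omega))

/-- Nothing lies outside `[a, b]`, so no block of the other parity can separate the two end points.
-/
theorem ends (h : IsPlanar a b R) (hab : a < b) (hp : a % 2 = b % 2) : ∃ V ∈ R, a ∈ V ∧ b ∈ V := by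
  refine h.maximal a b le_rfl hab le_rfl hp fun W hW u hu v hv hup _ _ => ?_
  have h1 := h.bounds W hW v hv
  have h2 := h.parity W hW u hu v hv
  omega

end IsPlanar

/-! ### Gluing along the block of the left end point -/

/-- Add `a` to the block containing `m`. -/
def attach (a m : ℕ) (V : Finset ℕ) : Finset ℕ := if m ∈ V then insert a V else V

theorem mem_attach {a m x : ℕ} {V : Finset ℕ} :
    x ∈ attach a m V ↔ x ∈ V ∨ (x = a ∧ m ∈ V) := by
  unfold attach
  split_ifs with h <;> simp [h, or_comm]

/-- Put a planar partition of `[a + 1, m - 1]` and one of `[m, b]` together, with `a` in the block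
of `m`. -/
def glue (a m : ℕ) (A B : Finset (Finset ℕ)) : Finset (Finset ℕ) := A ∪ B.image (attach a m)

theorem mem_glue {a m : ℕ} {A B : Finset (Finset ℕ)} {V : Finset ℕ} :
    V ∈ glue a m A B ↔ V ∈ A ∨ ∃ W ∈ B, attach a m W = V := by
  simp [glue]

/-- Here `m` becomes the second point of the block of `a`. The partition `A` fills the gap between
them, and `B` contains the rest of that block. -/
theorem IsPlanar.glue {a b m : ℕ} {A B : Finset (Finset ℕ)} (ham : a < m) (hmb : m ≤ b)
    (hp : m % 2 = a % 2) (hb : b % 2 = a % 2) (hA : IsPlanar (a + 1) (m - 1) A)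
    (hB : IsPlanar m b B) : IsPlanar a b (glue a m A B) := by
  -- A block of `A` spans its whole interval and a block of `B` spans `[m, b]`; these two witness
  -- every separation required below. One-point intervals are treated apart because `ends` needs
  -- distinct end points.
  obtain ⟨VA, hVA, hVA1, hVA2⟩ : ∃ V ∈ A, a + 1 ∈ V ∧ m - 1 ∈ V := by
    by_cases h : a + 1 < m - 1
    · exact hA.ends h (by omega)
    · obtain ⟨V, hV, hx⟩ := hA.cover (a + 1) le_rfl (by omega)
      have : m - 1 = a + 1 := by omega
      exact ⟨V, hV, hx, this ▸ hx⟩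
  obtain ⟨VB, hVB, hVB1, hVB2⟩ : ∃ V ∈ B, m ∈ V ∧ b ∈ V := by
    by_cases h : m < b
    · exact hB.ends h (by omega)
    · obtain ⟨V, hV, hx⟩ := hB.cover m le_rfl (by omega)
      have : b = m := by omega
      exact ⟨V, hV, hx, this ▸ hx⟩
  constructor
  · intro V hV
    rcases mem_glue.1 hV with hV | ⟨W, hW, rfl⟩
    · exact hA.nonempty V hV
    · obtain ⟨x, hx⟩ := hB.nonempty W hW
      exact ⟨x, mem_attach.2 (Or.inl hx)⟩
  · intro V hV x hx
    rcases mem_glue.1 hV with hV | ⟨W, hW, rfl⟩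
    · have := hA.bounds V hV x hx
      omega
    · rcases mem_attach.1 hx with hx | ⟨rfl, -⟩
      · have := hB.bounds W hW x hx
        omega
      · omega
  · intro x h1 h2
    rcases lt_or_ge x m with h | h
    · rcases h1.eq_or_lt with rfl | h1
      · exact ⟨_, mem_glue.2 (Or.inr ⟨VB, hVB, rfl⟩), mem_attach.2 (Or.inr ⟨rfl, hVB1⟩)⟩
      · obtain ⟨V, hV, hx⟩ := hA.cover x (by omega) (by omega)
        exact ⟨V, mem_glue.2 (Or.inl hV), hx⟩
    · obtain ⟨V, hV, hx⟩ := hB.cover x h h2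
      exact ⟨_, mem_glue.2 (Or.inr ⟨V, hV, rfl⟩), mem_attach.2 (Or.inl hx)⟩
  · intro V hV W hW x hx hx'
    replace hV := mem_glue.1 hV
    replace hW := mem_glue.1 hW
    rcases hV with hV | ⟨V, hV, rfl⟩ <;> rcases hW with hW | ⟨W, hW, rfl⟩
    · exact hA.eq_of_mem V hV W hW x hx hx'
    · have := hA.bounds V hV x hx
      rcases mem_attach.1 hx' with hx' | ⟨rfl, -⟩
      · have := hB.bounds W hW x hx'
        omega
      · omega
    · have := hA.bounds W hW x hx'
      rcases mem_attach.1 hx with hx | ⟨rfl, -⟩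
      · have := hB.bounds V hV x hx
        omega
      · omega
    · rcases mem_attach.1 hx with hx | ⟨rfl, hm⟩ <;> rcases mem_attach.1 hx' with hx' | ⟨h, hm'⟩
      · rw [hB.eq_of_mem V hV W hW x hx hx']
      · have := hB.bounds V hV x hx
        omega
      · have := hB.bounds W hW x hx'
        omega
      · rw [hB.eq_of_mem V hV W hW m hm hm']
  · intro V hV x hx y hy
    replace hV := mem_glue.1 hV
    rcases hV with hV | ⟨V, hV, rfl⟩
    · exact hA.parity V hV x hx y hy
    · rcases mem_attach.1 hx with hx | ⟨rfl, hm⟩ <;> rcases mem_attach.1 hy with hy | ⟨h, hm'⟩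
      · exact hB.parity V hV x hx y hy
      · have := hB.parity V hV x hx m hm'
        omega
      · have := hB.parity V hV m hm y hy
        omega
      · rw [h]
  · intro V hV W hW x hx y hy u hu v hv hup h1 h2
    replace hV := mem_glue.1 hV
    replace hW := mem_glue.1 hW
    rcases hV with hV | ⟨V, hV, rfl⟩ <;> rcases hW with hW | ⟨W, hW, rfl⟩
    · exact hA.noncross V hV W hW x hx y hy u hu v hv hup h1 h2
    · have e1 := hA.bounds V hV x hx
      have e2 := hA.bounds V hV y hy
      rcases mem_attach.1 hu with hu | ⟨rfl, -⟩
      · have := hB.bounds W hW u hu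
        omega
      · omega
    · have e1 := hA.bounds W hW u hu
      have e2 := hA.bounds W hW v hv
      rcases mem_attach.1 hx with hx | ⟨rfl, -⟩
      · have := hB.bounds V hV x hx
        omega
      · rcases mem_attach.1 hy with hy | ⟨rfl, -⟩
        · have := hB.bounds V hV y hy
          omega
        · omega
    · replace hu := mem_attach.1 hu
      rcases hu with hu | ⟨rfl, -⟩
      swap
      · replace hx := mem_attach.1 hx
        rcases hx with hx | ⟨rfl, -⟩
        · have := hB.bounds V hV x hx
          omega
        · omega
      have bu := hB.bounds W hW u hu
      replace hy := mem_attach.1 hy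
      rcases hy with hy | ⟨rfl, -⟩
      swap
      · omega
      have key : ∀ x ∈ V, x % 2 ≠ u % 2 → x < u → v ∈ W → x < v ∧ v < y := fun x hx hp h1 hv =>
        hB.noncross V hV W hW x hx y hy u hu v hv (Ne.symm hp) h1 h2
      replace hv := mem_attach.1 hv
      rcases hv with hv | ⟨rfl, hmW⟩
      · replace hx := mem_attach.1 hx
        rcases hx with hx | ⟨rfl, hmV⟩
        · exact key x hx (Ne.symm hup) h1 hv
        · have hmu : m ≠ u := by omega
          have := key m hmV (by omega) (by omega) hv
          omega
      · exfalso
        have e1 := hB.parity W hW u hu m hmW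
        replace hx := mem_attach.1 hx
        rcases hx with hx | ⟨rfl, hmV⟩
        · have e2 := hB.noncross V hV W hW x hx y hy u hu m hmW hup h1 h2
          have := hB.bounds V hV x hx
          omega
        · omega
  · intro x y h1 h2 h3 hxy hW
    have hWA : ∀ W ∈ A, ∀ u ∈ W, ∀ v ∈ W, u % 2 ≠ x % 2 → x < u → u < y → x < v ∧ v < y :=
      fun W hW' => hW W (mem_glue.2 (Or.inl hW'))
    have hWB : ∀ W ∈ B, ∀ u ∈ attach a m W, ∀ v ∈ attach a m W, u % 2 ≠ x % 2 → x < u → u < y →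
      x < v ∧ v < y := fun W hW' => hW _ (mem_glue.2 (Or.inr ⟨W, hW', rfl⟩))
    have hWB' : ∀ W ∈ B, ∀ u ∈ W, ∀ v ∈ W, u % 2 ≠ x % 2 → x < u → u < y →
      x < v ∧ v < y := fun W hW' u hu v hv => hWB W hW' u (mem_attach.2 (Or.inl hu)) v
        (mem_attach.2 (Or.inl hv))
    rcases lt_or_ge x m with hxm | hxm
    · rcases h1.eq_or_lt with rfl | h1
      · rcases lt_or_ge y m with hym | hym
        -- The spanning block of `A` contains `a + 1` and `m - 1`, and so separates `a` from each
        -- point of its own parity before `m`.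
        · exfalso
          have := hWA VA hVA (a + 1) hVA1 (m - 1) hVA2 (by omega) (by omega) (by omega)
          omega
        · rcases hym.eq_or_lt with rfl | hym
          · exact ⟨_, mem_glue.2 (Or.inr ⟨VB, hVB, rfl⟩), mem_attach.2 (Or.inr ⟨rfl, hVB1⟩),
              mem_attach.2 (Or.inl hVB1)⟩
          · obtain ⟨V, hV, hmV, hyV⟩ := hB.maximal m y le_rfl hym h3 (by omega)
              fun W hW u hu v hv hup hu1 hu2 => by
                have := hWB' W hW u hu v hv (by omega) (by omega) hu2
                have := hB.bounds W hW v hv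
                have := hB.parity W hW u hu v hv
                omega
            exact ⟨_, mem_glue.2 (Or.inr ⟨V, hV, rfl⟩), mem_attach.2 (Or.inr ⟨rfl, hmV⟩),
              mem_attach.2 (Or.inl hyV)⟩
      · rcases lt_or_ge y m with hym | hym
        · obtain ⟨V, hV, hx, hy⟩ := hA.maximal x y h1 h2 (by omega) hxy hWA
          exact ⟨V, mem_glue.2 (Or.inl hV), hx, hy⟩
        · exfalso
          -- A point strictly inside the gap is separated from one at or after `m` by `VA` if it has
          -- the parity of `a`, and by the glued block of `a` and `m` otherwise.
          by_cases hpx : x % 2 = a % 2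
          · have := hWA VA hVA (m - 1) hVA2 (a + 1) hVA1 (by omega) (by omega) (by omega)
            omega
          · have := hWB VB hVB m (mem_attach.2 (Or.inl hVB1)) a
              (mem_attach.2 (Or.inr ⟨rfl, hVB1⟩)) (by omega) (by omega) (by omega)
            omega
    · obtain ⟨V, hV, hx, hy⟩ := hB.maximal x y hxm h2 h3 hxy hWB'
      exact ⟨_, mem_glue.2 (Or.inr ⟨V, hV, rfl⟩), mem_attach.2 (Or.inl hx),
        mem_attach.2 (Or.inl hy)⟩

/-- Every planar partition of `[a, b]`, with `a < b` of equal parity, is obtained by gluing. -/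
theorem IsPlanar.exists_glue {a b : ℕ} {R : Finset (Finset ℕ)} (hab : a < b)
    (hp : a % 2 = b % 2) (h : IsPlanar a b R) :
    ∃ m, a < m ∧ m ≤ b ∧ m % 2 = a % 2 ∧ ∃ A B, IsPlanar (a + 1) (m - 1) A ∧ IsPlanar m b B ∧
      _root_.glue a m A B = R := by
  classical
  obtain ⟨V₀, hV₀, ha₀, hb₀⟩ := h.ends hab hp
  have hne : (V₀.erase a).Nonempty := ⟨b, Finset.mem_erase.2 ⟨by omega, hb₀⟩⟩
  -- The gluing point is the second smallest element of the block of `a`; it exists because that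
  -- block also contains `b`.
  obtain ⟨m, hm⟩ : ∃ m, m = (V₀.erase a).min' hne := ⟨_, rfl⟩
  have hm₀ : m ∈ V₀ := Finset.mem_of_mem_erase (hm ▸ Finset.min'_mem _ hne)
  have hma : m ≠ a := Finset.ne_of_mem_erase (hm ▸ Finset.min'_mem _ hne)
  have hmmin : ∀ x ∈ V₀, x ≠ a → m ≤ x := fun x hx hxa =>
    hm ▸ Finset.min'_le _ _ (Finset.mem_erase.2 ⟨hxa, hx⟩)
  have hmb := h.bounds V₀ hV₀ m hm₀
  have hmp := h.parity V₀ hV₀ m hm₀ a ha₀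
  have ham : a < m := by omega
  have hV₀A : ∀ W ∈ R, a ∈ W → W = V₀ := fun W hW ha => h.eq_of_mem W hW V₀ hV₀ a ha ha₀
  have inside : ∀ W ∈ R, ∀ u ∈ W, a < u → u < m → ∀ v ∈ W, a < v ∧ v < m := by
    intro W hW u hu h1 h2 v hv
    refine h.between hV₀ hW ?_ ha₀ hm₀ hu hv h1 h2
    rintro rfl
    have := hmmin u hu (by omega)
    omega
  set A := R.filter fun V => ∀ x ∈ V, a < x ∧ x < m with hA
  set B := (R.filter fun V => ¬ ∀ x ∈ V, a < x ∧ x < m).image fun V => V.erase a with hB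
  have memA : ∀ V, V ∈ A ↔ V ∈ R ∧ ∀ x ∈ V, a < x ∧ x < m := fun V => by simp [hA]
  have outside : ∀ V ∈ R, (¬ ∀ x ∈ V, a < x ∧ x < m) → ∀ x ∈ V, x ≠ a → m ≤ x := by
    intro V hV hout x hx hxa
    by_contra hlt
    have := h.bounds V hV x hx
    exact hout (inside V hV x hx (by omega) (by omega))
  have memB : ∀ V, V ∈ B ↔ ∃ W ∈ R, (¬ ∀ x ∈ W, a < x ∧ x < m) ∧ W.erase a = V := fun V => by
    simp only [hB, Finset.mem_image, Finset.mem_filter, and_assoc]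
  have hatt : ∀ W ∈ R, (¬ ∀ x ∈ W, a < x ∧ x < m) → attach a m (W.erase a) = W := by
    intro W hW hout
    ext x
    rw [mem_attach, Finset.mem_erase, Finset.mem_erase]
    constructor
    · rintro (hx | ⟨rfl, -, hm⟩)
      · exact hx.2
      · rwa [h.eq_of_mem W hW V₀ hV₀ m hm hm₀]
    · intro hx
      by_cases hxa : x = a
      · subst hxa
        exact Or.inr ⟨rfl, hma, by rwa [hV₀A W hW hx]⟩
      · exact Or.inl ⟨hxa, hx⟩
  have hout : ∀ W ∈ R, ∀ x ∈ W, m ≤ x → ¬ ∀ x ∈ W, a < x ∧ x < m := fun W hW x hx hmx hall => by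
    have := hall x hx
    omega
  refine ⟨m, ham, hmb.2, hmp, A, B, ?_, ?_, ?_⟩
  · constructor
    · exact fun V hV => h.nonempty V ((memA V).1 hV).1
    · intro V hV x hx
      have := ((memA V).1 hV).2 x hx
      omega
    · intro x h1 h2
      obtain ⟨V, hV, hx⟩ := h.cover x (by omega) (by omega)
      exact ⟨V, (memA V).2 ⟨hV, inside V hV x hx (by omega) (by omega)⟩, hx⟩
    · exact fun V hV W hW => h.eq_of_mem V ((memA V).1 hV).1 W ((memA W).1 hW).1
    · exact fun V hV => h.parity V ((memA V).1 hV).1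
    · exact fun V hV W hW => h.noncross V ((memA V).1 hV).1 W ((memA W).1 hW).1
    · intro x y h1 h2 h3 hxy hW
      obtain ⟨V, hV, hx, hy⟩ := h.maximal x y (by omega) h2 (by omega) hxy
        fun W hW' u hu v hv hup hu1 hu2 => hW W ((memA W).2
          ⟨hW', inside W hW' u hu (by omega) (by omega)⟩) u hu v hv hup hu1 hu2
      exact ⟨V, (memA V).2 ⟨hV, inside V hV x hx (by omega) (by omega)⟩, hx, hy⟩
  · constructor
    · intro V hV
      obtain ⟨W, hW, hWo, rfl⟩ := (memB V).1 hV
      by_cases ha : a ∈ W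
      · rw [hV₀A W hW ha]
        exact hne
      · rw [Finset.erase_eq_of_notMem ha]
        exact h.nonempty W hW
    · intro V hV x hx
      obtain ⟨W, hW, hWo, rfl⟩ := (memB V).1 hV
      rw [Finset.mem_erase] at hx
      exact ⟨outside W hW hWo x hx.2 hx.1, (h.bounds W hW x hx.2).2⟩
    · intro x h1 h2
      obtain ⟨V, hV, hx⟩ := h.cover x (by omega) h2
      exact ⟨_, (memB _).2 ⟨V, hV, hout V hV x hx h1, rfl⟩, Finset.mem_erase.2 ⟨by omega, hx⟩⟩
    · intro V hV W hW x hx hx'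
      replace hV := (memB V).1 hV
      obtain ⟨V, hV, hVo, rfl⟩ := hV
      replace hW := (memB W).1 hW
      obtain ⟨W, hW, hWo, rfl⟩ := hW
      rw [Finset.mem_erase] at hx hx'
      rw [h.eq_of_mem V hV W hW x hx.2 hx'.2]
    · intro V hV x hx y hy
      replace hV := (memB V).1 hV
      obtain ⟨V, hV, hVo, rfl⟩ := hV
      rw [Finset.mem_erase] at hx hy
      exact h.parity V hV x hx.2 y hy.2
    · intro V hV W hW x hx y hy u hu v hv
      replace hV := (memB V).1 hV
      obtain ⟨V, hV, hVo, rfl⟩ := hV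
      replace hW := (memB W).1 hW
      obtain ⟨W, hW, hWo, rfl⟩ := hW
      rw [Finset.mem_erase] at hx hy hu hv
      exact h.noncross V hV W hW x hx.2 y hy.2 u hu.2 v hv.2
    · intro x y h1 h2 h3 hxy hW
      have hWR : ∀ W ∈ R, ∀ u ∈ W, ∀ v ∈ W, u % 2 ≠ x % 2 → x < u → u < y → x < v ∧ v < y := by
        intro W hW' u hu v hv hup hu1 hu2
        have hWo := hout W hW' u hu (by omega)
        have key := hW _ ((memB _).2 ⟨W, hW', hWo, rfl⟩) u (Finset.mem_erase.2 ⟨by omega, hu⟩)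
        -- Erasing `a` from its block could lose a separation, but `b` lies in the same block and
        -- also falls outside the interval from `x` to `y`.
        by_cases hva : v = a
        · exfalso
          subst hva
          have hWV := hV₀A W hW' hv
          have := key b (Finset.mem_erase.2 ⟨by omega, hWV ▸ hb₀⟩) hup hu1 hu2
          omega
        · exact key v (Finset.mem_erase.2 ⟨hva, hv⟩) hup hu1 hu2
      obtain ⟨V, hV, hx, hy⟩ := h.maximal x y (by omega) h2 h3 hxy hWR
      exact ⟨_, (memB _).2 ⟨V, hV, hout V hV x hx h1, rfl⟩, Finset.mem_erase.2 ⟨by omega, hx⟩,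
        Finset.mem_erase.2 ⟨by omega, hy⟩⟩
  · ext V
    rw [mem_glue, memA]
    constructor
    · rintro (hV | ⟨W, hW, rfl⟩)
      · exact hV.1
      · replace hW := (memB W).1 hW
        obtain ⟨W, hW, hWo, rfl⟩ := hW
        rwa [hatt W hW hWo]
    · intro hV
      by_cases hVi : ∀ x ∈ V, a < x ∧ x < m
      · exact Or.inl ⟨hV, hVi⟩
      · exact Or.inr ⟨_, (memB _).2 ⟨V, hV, hVi, rfl⟩, hatt V hV hVi⟩

/-! ### Sums over planar partitions -/

open Classical in
/-- The planar partitions of `[a, b]`. -/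
noncomputable def planarPartitions (a b : ℕ) : Finset (Finset (Finset ℕ)) :=
  (Finset.Icc a b).powerset.powerset.filter (IsPlanar a b)

theorem mem_planarPartitions {a b : ℕ} {R : Finset (Finset ℕ)} :
    R ∈ planarPartitions a b ↔ IsPlanar a b R := by
  simp only [planarPartitions, Finset.mem_filter, Finset.mem_powerset, and_iff_right_iff_imp]
  intro h V hV
  rw [Finset.mem_powerset]
  intro x hx
  exact Finset.mem_Icc.2 (h.bounds V hV x hx)

/-- The sum over the planar partitions of `[a, b]`. -/
noncomputable def planarSum (Φ : Finset ℕ → ℂ) (a b : ℕ) : ℂ :=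
  ∑ R ∈ planarPartitions a b, ∏ V ∈ R, Φ V

theorem planarSum_self (Φ : Finset ℕ → ℂ) (a : ℕ) : planarSum Φ a a = Φ {a} := by
  have h : planarPartitions a a = {{{a}}} := by
    ext R
    rw [mem_planarPartitions, Finset.mem_singleton]
    constructor
    · intro h
      have hs : ∀ V ∈ R, V = {a} := by
        intro V hV
        obtain ⟨x, hx⟩ := h.nonempty V hV
        refine Finset.eq_singleton_iff_nonempty_unique_mem.2 ⟨⟨x, hx⟩, fun y hy => ?_⟩
        have := h.bounds V hV y hy
        omega
      obtain ⟨V, hV, -⟩ := h.cover a le_rfl le_rfl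
      ext W
      rw [Finset.mem_singleton]
      exact ⟨hs W, fun e => by rw [e, ← hs V hV]; exact hV⟩
    · rintro rfl
      constructor <;> simp
      · intros; omega
      · intros; omega
  rw [planarSum, h, Finset.sum_singleton, Finset.prod_singleton]

theorem attach_injOn {a m : ℕ} {V W : Finset ℕ} (hV : a ∉ V) (hW : a ∉ W)
    (h : attach a m V = attach a m W) : V = W := by
  ext x
  have hx := congrArg (x ∈ ·) h
  simp only [mem_attach, eq_iff_iff] at hx
  by_cases hxa : x = a
  · subst hxa
    simp [hV, hW]
  · simpa [hxa] using hx

/-- The block of `a` in a planar partition of `[a, b]` determines the decomposition. -/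
theorem planarSum_step (Φ : Finset ℕ → ℂ) {a b : ℕ} (hab : a < b) (hp : a % 2 = b % 2) :
    planarSum Φ a b = ∑ m ∈ (Finset.Ioc a b).filter (fun m => m % 2 = a % 2),
      planarSum Φ (a + 1) (m - 1) * planarSum (fun V => Φ (attach a m V)) m b := by
  classical
  simp only [planarSum, Finset.sum_mul_sum, ← Finset.sum_product']
  rw [Finset.sum_sigma', eq_comm]
  have hmem : ∀ s : Σ _ : ℕ, Finset (Finset ℕ) × Finset (Finset ℕ),
      s ∈ ((Finset.Ioc a b).filter (fun m => m % 2 = a % 2)).sigma (fun m =>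
        planarPartitions (a + 1) (m - 1) ×ˢ planarPartitions m b) ↔
      (a < s.1 ∧ s.1 ≤ b ∧ s.1 % 2 = a % 2) ∧ IsPlanar (a + 1) (s.1 - 1) s.2.1 ∧
        IsPlanar s.1 b s.2.2 := by
    intro s
    simp only [Finset.mem_sigma, Finset.mem_filter, Finset.mem_Ioc, Finset.mem_product,
      mem_planarPartitions, and_assoc]
  refine Finset.sum_bij (fun s _ => glue a s.1 s.2.1 s.2.2) ?_ ?_ ?_ ?_
  · intro s hs
    obtain ⟨⟨h1, h2, h3⟩, hA, hB⟩ := (hmem s).1 hs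
    exact mem_planarPartitions.2 (hA.glue h1 h2 h3 (by omega) hB)
  · rintro ⟨m, A, B⟩ hs ⟨m', A', B'⟩ hs' heq
    obtain ⟨⟨h1, h2, h3⟩, hA, hB⟩ := (hmem _).1 hs
    obtain ⟨⟨h1', h2', h3'⟩, hA', hB'⟩ := (hmem _).1 hs'
    dsimp only at *
    -- The gluing point can be recovered from the result: `m` shares a block with `a`, and in the
    -- other decomposition every further point of that block is at least `m'`.
    have hle : ∀ {m m' : ℕ} {A B A' B' : Finset (Finset ℕ)}, a < m → m ≤ b → a < m' →
        IsPlanar m b B → IsPlanar (a + 1) (m' - 1) A' →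
        IsPlanar m' b B' → glue a m A B = glue a m' A' B' → m' ≤ m := by
      intro m m' A B A' B' h1 h2 h1' hB hA' hB' heq
      obtain ⟨V, hV, hm⟩ := hB.cover m le_rfl h2
      have hV' : attach a m V ∈ glue a m' A' B' := heq ▸ mem_glue.2 (Or.inr ⟨V, hV, rfl⟩)
      have haV : a ∈ attach a m V := mem_attach.2 (Or.inr ⟨rfl, hm⟩)
      have hmV : m ∈ attach a m V := mem_attach.2 (Or.inl hm)
      rcases mem_glue.1 hV' with hV' | ⟨W, hW, hWV⟩
      · have := hA'.bounds _ hV' a haV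
        omega
      · rw [← hWV] at hmV
        rcases mem_attach.1 hmV with hmV | ⟨h, -⟩
        · exact (hB'.bounds W hW m hmV).1
        · omega
    obtain rfl : m = m' := le_antisymm (hle h1' h2' h1 hB' hA hB heq.symm)
      (hle h1 h2 h1' hB hA' hB' heq)
    have hAA : ∀ {A B A' B' : Finset (Finset ℕ)}, IsPlanar (a + 1) (m - 1) A → IsPlanar m b B' →
        glue a m A B = glue a m A' B' → A ⊆ A' := by
      intro A B A' B' hA hB' heq V hV
      have hV' : V ∈ glue a m A' B' := heq ▸ mem_glue.2 (Or.inl hV)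
      rcases mem_glue.1 hV' with hV' | ⟨W, hW, rfl⟩
      · exact hV'
      · exfalso
        obtain ⟨x, hx⟩ := hB'.nonempty W hW
        have := hB'.bounds W hW x hx
        have := hA.bounds _ hV x (mem_attach.2 (Or.inl hx))
        omega
    have hBB : ∀ {A B A' B' : Finset (Finset ℕ)}, IsPlanar (a + 1) (m - 1) A' → IsPlanar m b B →
        IsPlanar m b B' → glue a m A B = glue a m A' B' → B ⊆ B' := by
      intro A B A' B' hA' hB hB' heq V hV
      have hV' : attach a m V ∈ glue a m A' B' := heq ▸ mem_glue.2 (Or.inr ⟨V, hV, rfl⟩)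
      rcases mem_glue.1 hV' with hV' | ⟨W, hW, hWV⟩
      · exfalso
        obtain ⟨x, hx⟩ := hB.nonempty V hV
        have := hB.bounds V hV x hx
        have := hA'.bounds _ hV' x (mem_attach.2 (Or.inl hx))
        omega
      · have e : W = V := attach_injOn (fun ha => ?_) (fun ha => ?_) hWV
        · rwa [← e]
        · have := hB'.bounds W hW a ha
          omega
        · have := hB.bounds V hV a ha
          omega
    rw [(hAA hA hB' heq).antisymm (hAA hA' hB heq.symm),
      (hBB hA' hB hB' heq).antisymm (hBB hA hB' hB heq.symm)]
  · intro R hR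
    obtain ⟨m, h1, h2, h3, A, B, hA, hB, rfl⟩ :=
      (mem_planarPartitions.1 hR).exists_glue hab hp
    exact ⟨⟨m, A, B⟩, (hmem _).2 ⟨⟨h1, h2, h3⟩, hA, hB⟩, rfl⟩
  · rintro ⟨m, A, B⟩ hs
    obtain ⟨⟨h1, h2, h3⟩, hA, hB⟩ := (hmem _).1 hs
    dsimp only at *
    rw [glue, Finset.prod_union, Finset.prod_image]
    · intro V hV W hW hVW
      refine attach_injOn (fun ha => ?_) (fun ha => ?_) hVW
      · have := hB.bounds V hV a ha
        omega
      · have := hB.bounds W hW a ha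
        omega
    · rw [Finset.disjoint_left]
      intro V hV hV'
      obtain ⟨W, hW, rfl⟩ := Finset.mem_image.1 hV'
      obtain ⟨x, hx⟩ := hB.nonempty W hW
      have := hB.bounds W hW x hx
      have := hA.bounds _ hV x (mem_attach.2 (Or.inl hx))
      omega

/-! ### Word functions along a sequence of letters -/

namespace WordFn

variable {X : Type*}

/-- The value of a word function at a list, `0` at the empty list. -/
def eval (φ : WordFn X) : List X → ℂ
  | [] => 0
  | a :: t => φ a t

/-- The word `x i, x (i + 1), …` with `d` letters. -/
def seg (x : ℕ → X) (i d : ℕ) : List X := (List.range' i d).map x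

theorem seg_succ (x : ℕ → X) (i d : ℕ) : seg x i (d + 1) = x i :: seg x (i + 1) d := by
  simp [seg, List.range'_succ]

theorem seg_zero (x : ℕ → X) (i : ℕ) : seg x i 0 = [] := rfl

theorem conv_seg (φ ψ : WordFn X) (x : ℕ → X) (i d : ℕ) :
    conv φ ψ (x i) (seg x (i + 1) d) = ∑ k ∈ Finset.range (d + 1),
      φ (x i) (seg x (i + 1) k) * ψ (x (i + k)) (seg x (i + k + 1) (d - k)) := by
  induction d generalizing φ i with
  | zero => simp [seg_zero, conv_nil]
  | succ d ih =>
    rw [seg_succ, conv_cons, ih, Finset.sum_range_succ' _ (d + 1), add_comm]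
    congr 1
    · refine Finset.sum_congr rfl fun k hk => ?_
      rw [seg_succ x (i + 1) k, Nat.add_sub_add_right, show i + 1 + k = i + (k + 1) by omega]
      rfl

theorem two_seg (x : ℕ → X) (i d : ℕ) :
    (two : WordFn X) (x i) (seg x (i + 1) d) = if d = 1 then 1 else 0 := by
  simp [two, seg]

theorem conv_two_seg (φ : WordFn X) (x : ℕ → X) (i d : ℕ) :
    conv φ two (x i) (seg x (i + 1) (d + 1)) = φ (x i) (seg x (i + 1) d) := by
  rw [conv_seg, Finset.sum_eq_single_of_mem d (by simp)]
  · rw [two_seg, if_pos (by omega), mul_one]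
  · intro k hk hkd
    rw [two_seg, if_neg, mul_zero]
    have := Finset.mem_range.1 hk
    omega

theorem two_conv_seg (φ : WordFn X) (x : ℕ → X) (i d : ℕ) :
    conv two φ (x i) (seg x (i + 1) (d + 1)) = φ (x (i + 1)) (seg x (i + 2) d) := by
  rw [seg_succ]
  exact congrFun (congrFun (shift_two_conv φ (x i)) _) _

theorem subst_seg (φ L : WordFn X) (x : ℕ → X) (i d : ℕ) :
    subst φ L (x i) (seg x (i + 1) (d + 1)) = ∑ k ∈ Finset.range (d + 1),
      L (x i) (seg x (i + 1) (k + 1)) *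
        subst (shift (x i) φ) L (x (i + (k + 1))) (seg x (i + (k + 1) + 1) (d - k)) := by
  rw [seg_succ, subst_cons, conv_seg]
  refine Finset.sum_congr rfl fun k _ => ?_
  rw [seg_succ x (i + 1) k, show i + 1 + k = i + (k + 1) by omega]
  rfl

end WordFn

open WordFn

/-! ### Planar sums as overlapping products -/

section PlanarSums

variable {X : Type*}

/-- The word formed by the letters `x i`, `i < n`, for which `e i` lies in `V`. -/
def pick (n : ℕ) (x : ℕ → X) (e : ℕ → ℕ) (V : Finset ℕ) : List X :=
  (((Finset.range n).filter fun i => e i ∈ V).sort (· ≤ ·)).map x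

theorem pick_insert {n : ℕ} (x : ℕ → X) {e : ℕ → ℕ} (he : StrictMono e) {i : ℕ} (hi : i < n)
    {V : Finset ℕ} (hV : ∀ v ∈ V, e i < v) :
    pick n x e (insert (e i) V) = x i :: pick n x e V := by
  have h : (Finset.range n).filter (fun j => e j ∈ insert (e i) V) =
      insert i ((Finset.range n).filter fun j => e j ∈ V) := by
    ext j
    simp only [Finset.mem_filter, Finset.mem_range, Finset.mem_insert, he.injective.eq_iff]
    constructor
    · tauto
    · rintro (rfl | h)
      · exact ⟨hi, Or.inl rfl⟩
      · exact ⟨h.1, Or.inr h.2⟩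
  rw [pick, h, Finset.sort_insert]
  · rfl
  · intro j hj
    exact (he.lt_iff_lt.1 (hV _ (Finset.mem_filter.1 hj).2)).le
  · intro hi'
    exact (hV _ (Finset.mem_filter.1 hi').2).ne rfl

theorem pick_ne_nil {n : ℕ} (x : ℕ → X) {e : ℕ → ℕ} {i : ℕ} (hi : i < n) {V : Finset ℕ}
    (hV : e i ∈ V) : pick n x e V ≠ [] := by
  intro h
  have hmem : i ∈ ((Finset.range n).filter fun i => e i ∈ V).sort (· ≤ ·) := by
    simp [hi, hV]
  rw [pick, List.map_eq_nil_iff] at h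
  rw [h] at hmem
  simp at hmem

/-- The index `j` guarantees that something remains after the first letter: at the empty word `eval`
takes the default value `0`, and the identity could fail. -/
theorem eval_pick_insert {n : ℕ} (φ : WordFn X) (x : ℕ → X) {e : ℕ → ℕ} (he : StrictMono e)
    {i j : ℕ} (hi : i < n) (hj : j < n) {V : Finset ℕ} (hV : ∀ v ∈ V, e i < v) (hjV : e j ∈ V) :
    eval φ (pick n x e (insert (e i) V)) = eval (shift (x i) φ) (pick n x e V) := by
  rw [pick_insert x he hi hV]
  obtain ⟨a, t, ht⟩ := List.exists_cons_of_ne_nil (pick_ne_nil x hj hjV)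
  rw [ht]
  rfl

theorem pick_singleton {n : ℕ} (x : ℕ → X) {e : ℕ → ℕ} (he : StrictMono e) {i : ℕ} (hi : i < n) :
    pick n x e {e i} = [x i] := by
  have := pick_insert x he hi (V := ∅) (by simp)
  simpa [pick] using this

theorem sum_Ioc_filter_parity (f : ℕ → ℂ) (a d : ℕ) :
    ∑ m ∈ (Finset.Ioc a (a + 2 * d)).filter (fun m => m % 2 = a % 2), f m =
      ∑ k ∈ Finset.range d, f (a + 2 * (k + 1)) := by
  refine Finset.sum_nbij' (fun m => (m - a) / 2 - 1) (fun k => a + 2 * (k + 1)) ?_ ?_ ?_ ?_ ?_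
  · intro m hm
    simp only [Finset.mem_filter, Finset.mem_Ioc, Finset.mem_range] at hm ⊢
    omega
  · intro k hk
    simp only [Finset.mem_filter, Finset.mem_Ioc, Finset.mem_range] at hk ⊢
    omega
  · intro m hm
    simp only [Finset.mem_filter, Finset.mem_Ioc] at hm
    omega
  · intro k hk
    omega
  · intro m hm
    simp only [Finset.mem_filter, Finset.mem_Ioc] at hm
    congr 1
    omega

/-- The position of the letter `x i`. -/
def oddPt (i : ℕ) : ℕ := 2 * i + 1

/-- The position of the point following the letter `x i`. -/
def evenPt (i : ℕ) : ℕ := 2 * i + 2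

theorem oddPt_strictMono : StrictMono oddPt := fun i j h => by unfold oddPt; omega

theorem evenPt_strictMono : StrictMono evenPt := fun i j h => by unfold evenPt; omega

/-- Odd and even intervals are treated in one induction, because the gap after the first point of
either kind is an interval of the other kind. The block of the left end point carries its own weight
`φ` or `γ`: gluing a point in front of it replaces this weight by its shift. The factor `two`
records the step between the letters on the two sides of a gap. -/
theorem planarSum_eq_subst (F G : WordFn X) (n : ℕ) (x : ℕ → X) (d : ℕ) :
    (∀ (φ : WordFn X) (Φ : Finset ℕ → ℂ) (i : ℕ), i + d < n →
      (∀ V : Finset ℕ, V.Nonempty → (∀ v ∈ V, 2 * i + 1 ≤ v ∧ v ≤ 2 * (i + d) + 1) →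
        (∀ v ∈ V, v % 2 = 1) → 2 * i + 1 ∈ V → Φ V = eval φ (pick n x oddPt V)) →
      (∀ V : Finset ℕ, V.Nonempty → (∀ v ∈ V, 2 * i + 1 ≤ v ∧ v ≤ 2 * (i + d) + 1) →
        (∀ v ∈ V, v % 2 = 1) → 2 * i + 1 ∉ V → Φ V = eval F (pick n x oddPt V)) →
      (∀ V : Finset ℕ, V.Nonempty → (∀ v ∈ V, 2 * i + 1 ≤ v ∧ v ≤ 2 * (i + d) + 1) →
        (∀ v ∈ V, v % 2 = 0) → Φ V = eval G (pick n x evenPt V)) →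
      planarSum Φ (2 * i + 1) (2 * i + 1 + 2 * d) =
        subst φ (conv (planarSnd F G) two) (x i) (seg x (i + 1) d)) ∧
    (∀ (γ : WordFn X) (Φ : Finset ℕ → ℂ) (i : ℕ), i + d < n →
      (∀ V : Finset ℕ, V.Nonempty → (∀ v ∈ V, 2 * i + 2 ≤ v ∧ v ≤ 2 * (i + d) + 2) →
        (∀ v ∈ V, v % 2 = 0) → 2 * i + 2 ∈ V → Φ V = eval γ (pick n x evenPt V)) →
      (∀ V : Finset ℕ, V.Nonempty → (∀ v ∈ V, 2 * i + 2 ≤ v ∧ v ≤ 2 * (i + d) + 2) →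
        (∀ v ∈ V, v % 2 = 0) → 2 * i + 2 ∉ V → Φ V = eval G (pick n x evenPt V)) →
      (∀ V : Finset ℕ, V.Nonempty → (∀ v ∈ V, 2 * i + 2 ≤ v ∧ v ≤ 2 * (i + d) + 2) →
        (∀ v ∈ V, v % 2 = 1) → Φ V = eval F (pick n x oddPt V)) →
      planarSum Φ (2 * i + 2) (2 * i + 2 + 2 * d) =
        subst γ (conv two (planarFst F G)) (x i) (seg x (i + 1) d)) := by
  induction d using Nat.strong_induction_on with
  | _ d ih =>
  rcases d with _ | d
  · constructor
    · intro φ Φ i hi h1 h2 h3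
      rw [Nat.mul_zero, Nat.add_zero, planarSum_self, seg_zero, subst_nil, h1 _ (by simp)]
      · rw [show 2 * i + 1 = oddPt i from rfl, pick_singleton x oddPt_strictMono (by omega)]
        rfl
      all_goals simp
    · intro φ Φ i hi h1 h2 h3
      rw [Nat.mul_zero, Nat.add_zero, planarSum_self, seg_zero, subst_nil, h1 _ (by simp)]
      · rw [show 2 * i + 2 = evenPt i from rfl, pick_singleton x evenPt_strictMono (by omega)]
        rfl
      all_goals simp
  · constructor
    · intro φ Φ i hi h1 h2 h3
      rw [planarSum_step Φ (by omega) (by omega), sum_Ioc_filter_parity, subst_seg]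
      refine Finset.sum_congr rfl fun k hk => ?_
      have hk := Finset.mem_range.1 hk
      congr 1
      -- Inside the gap no block is distinguished, so the induction hypothesis is used with the
      -- ordinary weight `G`.
      · rw [conv_two_seg, planarSnd, show 2 * i + 1 + 2 * (k + 1) - 1 = 2 * i + 2 + 2 * k by omega]
        refine (ih k (by omega)).2 G Φ i (by omega) ?_ ?_ ?_
        · exact fun V hV hb hp _ => h3 V hV (fun v hv => by have := hb v hv; omega) hp
        · exact fun V hV hb hp _ => h3 V hV (fun v hv => by have := hb v hv; omega) hp
        · refine fun V hV hb hp => h2 V hV (fun v hv => ?_) hp fun hv => ?_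
          · have := hb v hv; have := hp v hv; omega
          · have := hb _ hv; omega
      · rw [show 2 * i + 1 + 2 * (k + 1) = 2 * (i + (k + 1)) + 1 by omega,
          show 2 * i + 1 + 2 * (d + 1) = 2 * (i + (k + 1)) + 1 + 2 * (d - k) by omega]
        -- In the remainder, the block of its left end point has already received the letter `x i`.
        refine (ih (d - k) (by omega)).1 (shift (x i) φ) _ (i + (k + 1)) (by omega) ?_ ?_ ?_
        · intro V hV hb hp hm
          rw [attach, if_pos hm, h1 _ (Finset.insert_nonempty _ _)]
          · refine eval_pick_insert φ x oddPt_strictMono (j := i + (k + 1)) (by omega) (by omega)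
              (fun v hv => ?_) hm
            have := hb v hv
            unfold oddPt
            omega
          · intro v hv
            rcases Finset.mem_insert.1 hv with rfl | hv
            · omega
            · have := hb v hv; omega
          · intro v hv
            rcases Finset.mem_insert.1 hv with rfl | hv
            · omega
            · exact hp v hv
          · exact Finset.mem_insert_self _ _
        · intro V hV hb hp hm
          rw [attach, if_neg hm]
          refine h2 V hV (fun v hv => ?_) hp fun hv => ?_
          · have := hb v hv; omega
          · have := hb _ hv; omega
        · intro V hV hb hp
          rw [attach, if_neg fun hm => by have := hp _ hm; omega]
          exact h3 V hV (fun v hv => by have := hb v hv; omega) hp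
    · intro φ Φ i hi h1 h2 h3
      rw [planarSum_step Φ (by omega) (by omega), sum_Ioc_filter_parity, subst_seg]
      refine Finset.sum_congr rfl fun k hk => ?_
      have hk := Finset.mem_range.1 hk
      congr 1
      -- A gap between even points starts at the next letter `x (i + 1)`, which explains `two` on
      -- the left of `planarFst`.
      · rw [two_conv_seg, planarFst_eq, show 2 * i + 2 + 1 = 2 * (i + 1) + 1 by omega,
          show 2 * i + 2 + 2 * (k + 1) - 1 = 2 * (i + 1) + 1 + 2 * k by omega]
        refine (ih k (by omega)).1 F Φ (i + 1) (by omega) ?_ ?_ ?_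
        · exact fun V hV hb hp _ => h3 V hV (fun v hv => by have := hb v hv; omega) hp
        · exact fun V hV hb hp _ => h3 V hV (fun v hv => by have := hb v hv; omega) hp
        · refine fun V hV hb hp => h2 V hV (fun v hv => ?_) hp fun hv => ?_
          · have := hb v hv; have := hp v hv; omega
          · have := hb _ hv; omega
      · rw [show 2 * i + 2 + 2 * (k + 1) = 2 * (i + (k + 1)) + 2 by omega,
          show 2 * i + 2 + 2 * (d + 1) = 2 * (i + (k + 1)) + 2 + 2 * (d - k) by omega]
        refine (ih (d - k) (by omega)).2 (shift (x i) φ) _ (i + (k + 1)) (by omega) ?_ ?_ ?_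
        · intro V hV hb hp hm
          rw [attach, if_pos hm, h1 _ (Finset.insert_nonempty _ _)]
          · refine eval_pick_insert φ x evenPt_strictMono (j := i + (k + 1)) (by omega) (by omega)
              (fun v hv => ?_) hm
            have := hb v hv
            unfold evenPt
            omega
          · intro v hv
            rcases Finset.mem_insert.1 hv with rfl | hv
            · omega
            · have := hb v hv; omega
          · intro v hv
            rcases Finset.mem_insert.1 hv with rfl | hv
            · omega
            · exact hp v hv
          · exact Finset.mem_insert_self _ _
        · intro V hV hb hp hm
          rw [attach, if_neg hm]
          refine h2 V hV (fun v hv => ?_) hp fun hv => ?_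
          · have := hb v hv; omega
          · have := hb _ hv; omega
        · intro V hV hb hp
          rw [attach, if_neg fun hm => by have := hp _ hm; omega]
          exact h3 V hV (fun v hv => by have := hb v hv; omega) hp

/-- The weight of a block of odd points (letters) or of even points. -/
noncomputable def blockWeight (F G : WordFn X) (n : ℕ) (x : ℕ → X) (V : Finset ℕ) : ℂ :=
  if ∃ v ∈ V, v % 2 = 1 then eval F (pick n x oddPt V) else eval G (pick n x evenPt V)

/-- The second point `2 * (k + 1)` of the block of `0` cuts the picture into a part from letter to
letter, summing to `planarFst`, and a part from gap to gap, summing to `planarSnd`. Both words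
contain `x k`, whence the overlapping product. -/
theorem planarSum_blockWeight (F G : WordFn X) (n : ℕ) (x : ℕ → X) :
    planarSum (blockWeight F G (n + 1) x) 0 (2 * (n + 1)) = box F G (x 0) (seg x 1 n) := by
  have hodd : ∀ V : Finset ℕ, V.Nonempty → (∀ v ∈ V, v % 2 = 1) →
      blockWeight F G (n + 1) x V = eval F (pick (n + 1) x oddPt V) := by
    intro V ⟨v, hv⟩ hp
    rw [blockWeight, if_pos ⟨v, hv, hp v hv⟩]
  have heven : ∀ V : Finset ℕ, (∀ v ∈ V, v % 2 = 0) →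
      blockWeight F G (n + 1) x V = eval G (pick (n + 1) x evenPt V) := by
    intro V hp
    rw [blockWeight, if_neg]
    rintro ⟨v, hv, hv'⟩
    have := hp v hv
    omega
  have h := sum_Ioc_filter_parity (fun m => planarSum (blockWeight F G (n + 1) x) (0 + 1) (m - 1) *
    planarSum (fun V => blockWeight F G (n + 1) x (attach 0 m V)) m (2 * (n + 1))) 0 (n + 1)
  rw [zero_add] at h
  have hbox : box F G (x 0) (seg x 1 n) = ∑ k ∈ Finset.range (n + 1),
      planarFst F G (x 0) (seg x 1 k) * planarSnd F G (x k) (seg x (k + 1) (n - k)) := by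
    have := conv_seg (planarFst F G) (planarSnd F G) x 0 n
    simpa only [Nat.zero_add, box] using this
  rw [planarSum_step _ (by omega) (by omega), h, hbox]
  clear h hbox
  refine Finset.sum_congr rfl fun k hk => ?_
  have hk := Finset.mem_range.1 hk
  rw [Nat.zero_add, Nat.zero_add]
  have h1 : planarSum (blockWeight F G (n + 1) x) 1 (2 * (k + 1) - 1) =
      planarFst F G (x 0) (seg x 1 k) := by
    have := (planarSum_eq_subst F G (n + 1) x k).1 F (blockWeight F G (n + 1) x) 0 (by omega)
      (fun V hV _ hp _ => hodd V hV hp) (fun V hV _ hp _ => hodd V hV hp)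
      (fun V hV _ hp => heven V hp)
    rw [← planarFst_eq, Nat.mul_zero, Nat.zero_add] at this
    rw [show 2 * (k + 1) - 1 = 1 + 2 * k by omega]
    exact this
  have h2 : planarSum (fun V => blockWeight F G (n + 1) x (attach 0 (2 * (k + 1)) V))
      (2 * (k + 1)) (2 * (n + 1)) = planarSnd F G (x k) (seg x (k + 1) (n - k)) := by
    -- The point `0` duplicates the last gap and is not of the form `evenPt j`, so attaching it
    -- leaves the weight unchanged.
    have hatt : ∀ m, ∀ V : Finset ℕ, (∀ v ∈ V, v % 2 = 0) →
        blockWeight F G (n + 1) x (attach 0 m V) = eval G (pick (n + 1) x evenPt V) := by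
      intro m V hp
      rw [heven]
      · have hV : ∀ j, evenPt j ∈ attach 0 m V ↔ evenPt j ∈ V := fun j => by
          rw [mem_attach]
          simp [evenPt]
        simp only [pick, hV]
      · intro v hv
        rcases mem_attach.1 hv with hv | ⟨rfl, -⟩
        · exact hp v hv
        · rfl
    have := (planarSum_eq_subst F G (n + 1) x (n - k)).2 G
      (fun V => blockWeight F G (n + 1) x (attach 0 (2 * (k + 1)) V)) k (by omega)
      (fun V _ _ hp _ => hatt _ V hp) (fun V _ _ hp _ => hatt _ V hp) ?_
    · rw [show 2 * (n + 1) = 2 * k + 2 + 2 * (n - k) by omega]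
      exact this
    · intro V hV hb hp
      rw [attach, if_neg fun hm => by have := hp _ hm; omega]
      exact hodd V hV hp
  rw [h1, h2]

end PlanarSums

/-! ### Non-crossing partitions and planar partitions -/

/-- A block lies wholly inside or wholly outside the interval between two gaps exactly when
separation by its points is constant along the block. This form is symmetric and needs no minimum or
maximum. -/
theorem kreweras_mem_iff {n : ℕ} (π : Partn n) (i j : Fin n) :
    (∃ V ∈ (kreweras π).parts, i ∈ V ∧ j ∈ V) ↔
      ∀ V ∈ π.parts, ∀ a ∈ V, ∀ b ∈ V, ((i < a ↔ j < a) ↔ (i < b ↔ j < b)) := by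
  have hm : ∀ a : Fin n, a ∈ Finset.Ioc (min i j) (max i j) ↔ ¬ (i < a ↔ j < a) := by
    intro a
    rw [Finset.mem_Ioc]
    rcases le_total i j with h | h
    · rw [min_eq_left h, max_eq_right h]; omega
    · rw [min_eq_right h, max_eq_left h]; omega
  have h1 : (∃ V ∈ (kreweras π).parts, i ∈ V ∧ j ∈ V) ↔ krewerasSetoid π i j := by
    constructor
    · rintro ⟨V, hV, hi, hj⟩
      exact kreweras_rel hV hi hj
    · intro h
      exact ⟨_, (kreweras π).part_mem.2 (Finset.mem_univ i),
        (kreweras π).mem_part (Finset.mem_univ i), Finpartition.mem_part_ofSetoid_iff_rel.2 h⟩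
  rw [h1]
  change (∀ V ∈ π.parts, _) ↔ _
  refine forall₂_congr fun V hV => ?_
  constructor
  · rintro (h | h) a ha b hb
    · have h1 := (hm a).1 (h ha)
      have h2 := (hm b).1 (h hb)
      tauto
    · have h1 := (hm a).not.1 (Finset.disjoint_left.1 h ha)
      have h2 := (hm b).not.1 (Finset.disjoint_left.1 h hb)
      tauto
  · intro h
    obtain ⟨a, ha⟩ := π.nonempty_of_mem_parts hV
    by_cases h1 : (i < a ↔ j < a)
    · right
      rw [Finset.disjoint_left]
      intro b hb
      rw [hm b]
      have := h a ha b hb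
      tauto
    · left
      intro b hb
      rw [hm b]
      have := h a ha b hb
      tauto

theorem NonCrossing.between {n : ℕ} {π : Partn n} (h : NonCrossing π.parts)
    {V W : Finset (Fin n)} (hV : V ∈ π.parts) (hW : W ∈ π.parts) (hne : V ≠ W) {x y u v : Fin n}
    (hx : x ∈ V) (hy : y ∈ V) (hu : u ∈ W) (hv : v ∈ W) (h1 : x < u) (h2 : u < y) :
    x < v ∧ v < y := by
  have hvx : v ≠ x := fun e => hne (π.eq_of_mem_parts hV hW hx (e ▸ hv))
  have hvy : v ≠ y := fun e => hne (π.eq_of_mem_parts hV hW hy (e ▸ hv))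
  refine ⟨?_, ?_⟩
  · by_contra hc
    exact hne (h W hW V hV v x u y (by omega) h1 h2 hv hu hx hy).symm
  · by_contra hc
    exact hne (h V hV W hW x u y v h1 h2 (by omega) hx hy hu hv)

/-! ### The picture of a partition and its complement -/

/-- The block `V` of letters, as a set of odd points. -/
def oddBlock {n : ℕ} (V : Finset (Fin n)) : Finset ℕ := V.image fun i : Fin n => oddPt i

/-- The block `V` of gaps, as a set of even points; `0` is identified with the last point. -/
def evenBlock {n : ℕ} (V : Finset (Fin n)) : Finset ℕ :=
  attach 0 (2 * n) (V.image fun i : Fin n => evenPt i)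

theorem mem_oddBlock {n : ℕ} {V : Finset (Fin n)} {t : ℕ} :
    t ∈ oddBlock V ↔ ∃ i ∈ V, t = 2 * (i : ℕ) + 1 := by
  simp [oddBlock, oddPt, eq_comm]

theorem mem_evenBlock {n : ℕ} {V : Finset (Fin n)} {t : ℕ} :
    t ∈ evenBlock V ↔ ∃ i ∈ V, t = 2 * (i : ℕ) + 2 ∨ (t = 0 ∧ (i : ℕ) + 1 = n) := by
  rw [evenBlock, mem_attach, Finset.mem_image, Finset.mem_image]
  constructor
  · rintro (⟨i, hi, rfl⟩ | ⟨rfl, i, hi, h⟩)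
    · exact ⟨i, hi, Or.inl rfl⟩
    · exact ⟨i, hi, Or.inr ⟨rfl, by unfold evenPt at h; omega⟩⟩
  · rintro ⟨i, hi, rfl | ⟨rfl, h⟩⟩
    · exact Or.inl ⟨i, hi, rfl⟩
    · exact Or.inr ⟨rfl, i, hi, by unfold evenPt; omega⟩

/-- The planar partition formed by `π` and its Kreweras complement. -/
def toPlanar {n : ℕ} (π : Partn n) : Finset (Finset ℕ) :=
  π.parts.image oddBlock ∪ (kreweras π).parts.image evenBlock

theorem mem_toPlanar {n : ℕ} {π : Partn n} {R : Finset ℕ} : R ∈ toPlanar π ↔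
    (∃ V ∈ π.parts, oddBlock V = R) ∨ ∃ V ∈ (kreweras π).parts, evenBlock V = R := by
  simp [toPlanar]

theorem exists_even_index {n t : ℕ} (hn : 0 < n) (h : t ≤ 2 * n) (ht : t % 2 = 0) :
    ∃ i : Fin n, t = 2 * (i : ℕ) + 2 ∨ (t = 0 ∧ (i : ℕ) + 1 = n) := by
  rcases Nat.eq_zero_or_pos t with rfl | h0
  · exact ⟨⟨n - 1, by omega⟩, Or.inr ⟨rfl, by simp; omega⟩⟩
  · exact ⟨⟨t / 2 - 1, by omega⟩, Or.inl (by simp; omega)⟩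

theorem oddBlock_injective {n : ℕ} : Function.Injective (oddBlock : Finset (Fin n) → _) := by
  intro V W h
  ext i
  have h1 : ∀ V : Finset (Fin n), 2 * (i : ℕ) + 1 ∈ oddBlock V ↔ i ∈ V := fun V => by
    rw [mem_oddBlock]
    constructor
    · rintro ⟨j, hj, h⟩
      have : i = j := by omega
      rwa [this]
    · exact fun hi => ⟨i, hi, rfl⟩
  rw [← h1 V, ← h1 W, h]

theorem evenPt_mem_evenBlock {n : ℕ} {V : Finset (Fin n)} {i : Fin n} :
    2 * (i : ℕ) + 2 ∈ evenBlock V ↔ i ∈ V := by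
  rw [mem_evenBlock]
  constructor
  · rintro ⟨j, hj, h⟩
    have : i = j := by omega
    rwa [this]
  · exact fun hi => ⟨i, hi, Or.inl rfl⟩

theorem evenBlock_injective {n : ℕ} : Function.Injective (evenBlock : Finset (Fin n) → _) := by
  intro V W h
  ext i
  rw [← evenPt_mem_evenBlock, h, evenPt_mem_evenBlock]

theorem Finpartition.exists_block {n : ℕ} (π : Partn n) (i : Fin n) : ∃ V ∈ π.parts, i ∈ V :=
  π.exists_mem (Finset.mem_univ i)

/-- The gaps following two neighbours `p < q` in a block are related in the complement. -/
theorem NonCrossing.rel_of_gap {n : ℕ} {π : Partn n} (h : NonCrossing π.parts)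
    {V : Finset (Fin n)} (hV : V ∈ π.parts) {p q r : Fin n} (hp : p ∈ V) (hq : q ∈ V)
    (hpq : p < q) (hr : (r : ℕ) + 1 = q) (hgap : ∀ a ∈ V, a ≤ p ∨ q ≤ a) :
    ∀ U ∈ π.parts, ∀ a ∈ U, ∀ b ∈ U, ((p < a ↔ r < a) ↔ (p < b ↔ r < b)) := by
  intro U hU a ha b hb
  by_cases hUV : V = U
  · subst hUV
    have h1 := hgap a ha
    have h2 := hgap b hb
    omega
  · have hnm : ∀ c ∈ U, c ≠ p ∧ c ≠ q := fun c hc =>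
      ⟨fun e => hUV (π.eq_of_mem_parts hV hU hp (e ▸ hc)),
        fun e => hUV (π.eq_of_mem_parts hV hU hq (e ▸ hc))⟩
    have h1 := h.between hV hU hUV hp hq ha hb
    have h2 := h.between hV hU hUV hp hq hb ha
    have h3 := hnm a ha
    have h4 := hnm b hb
    omega

/-- Two neighbours of a point outside a block. -/
theorem exists_neighbours {n : ℕ} {V : Finset (Fin n)} {i j k : Fin n} (hi : i ∈ V) (hk : k ∈ V)
    (hij : i < j) (hjk : j < k) (hj : j ∉ V) :
    ∃ p ∈ V, ∃ q ∈ V, i ≤ p ∧ p < j ∧ j < q ∧ ∀ a ∈ V, a ≤ p ∨ q ≤ a := by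
  have hne : (V.filter (· < j)).Nonempty := ⟨i, Finset.mem_filter.2 ⟨hi, hij⟩⟩
  have hne' : (V.filter (j < ·)).Nonempty := ⟨k, Finset.mem_filter.2 ⟨hk, hjk⟩⟩
  have hp := Finset.mem_filter.1 (Finset.max'_mem _ hne)
  have hq := Finset.mem_filter.1 (Finset.min'_mem _ hne')
  refine ⟨_, hp.1, _, hq.1, Finset.le_max' _ i (Finset.mem_filter.2 ⟨hi, hij⟩), hp.2, hq.2, ?_⟩
  intro a ha
  rcases lt_trichotomy a j with h1 | h1 | h1
  · exact Or.inl (Finset.le_max' _ a (Finset.mem_filter.2 ⟨ha, h1⟩))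
  · exact absurd (h1 ▸ ha) hj
  · exact Or.inr (Finset.min'_le _ a (Finset.mem_filter.2 ⟨ha, h1⟩))

/-- In a non-crossing partition, letters which no block of the complement separates are in the
same block. -/
theorem NonCrossing.mem_of_not_separated {n : ℕ} {π : Partn n} (h : NonCrossing π.parts)
    {i j : Fin n} (hij : i < j)
    (hK : ∀ W ∈ (kreweras π).parts, ∀ u ∈ evenBlock W, ∀ v ∈ evenBlock W,
      2 * (i : ℕ) + 1 < u → u < 2 * (j : ℕ) + 1 → 2 * (i : ℕ) + 1 < v ∧ v < 2 * (j : ℕ) + 1) :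
    ∃ V ∈ π.parts, i ∈ V ∧ j ∈ V := by
  obtain ⟨V, hV, hi⟩ := Finpartition.exists_block π i
  refine ⟨V, hV, hi, ?_⟩
  by_contra hj
  -- It suffices to find two related gaps, one between `i` and `j` and one outside.
  have hrel : ∀ p q : Fin n, ∀ t : ℕ, (t = 2 * (q : ℕ) + 2 ∨ (t = 0 ∧ (q : ℕ) + 1 = n)) →
      i ≤ p → p < j → (t ≤ 2 * (i : ℕ) ∨ 2 * (j : ℕ) + 2 ≤ t) →
      (∀ U ∈ π.parts, ∀ a ∈ U, ∀ b ∈ U, ((p < a ↔ q < a) ↔ (p < b ↔ q < b))) → False := by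
    intro p q t ht h1 h2 h3 hr
    obtain ⟨W, hW, hp, hq⟩ := (kreweras_mem_iff π p q).2 hr
    have := hK W hW (2 * (p : ℕ) + 2) (mem_evenBlock.2 ⟨p, hp, Or.inl rfl⟩) t
      (mem_evenBlock.2 ⟨q, hq, ht⟩) (by omega) (by omega)
    omega
  by_cases hright : ∃ k ∈ V, j < k
  · obtain ⟨k, hk, hjk⟩ := hright
    -- If the block of `i` continues beyond `j`, take the gaps just after and just before its two
    -- points around `j`.
    obtain ⟨p, hp, q, hq, hip, hpj, hjq, hgap⟩ := exists_neighbours hi hk hij hjk hj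
    exact hrel p ⟨(q : ℕ) - 1, by omega⟩ (2 * (q : ℕ)) (Or.inl (by simp; omega)) hip hpj
      (by omega) (h.rel_of_gap hV hp hq (by omega) (by simp; omega) hgap)
  · have hlt : ∀ a ∈ V, a < j := by
      intro a ha
      rcases lt_trichotomy a j with h1 | h1 | h1
      · exact h1
      · exact absurd (h1 ▸ ha) hj
      · exact absurd ⟨a, ha, h1⟩ hright
    -- Otherwise take the gap after the last point of the block and the gap before its first point.
    -- If the first point is the first letter, the latter gap is the point `0`, represented by the
    -- last index.
    obtain ⟨p, hp⟩ : ∃ p, p = V.max' ⟨i, hi⟩ := ⟨_, rfl⟩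
    have hpm : p ∈ V := hp ▸ Finset.max'_mem _ _
    have hle : ∀ a ∈ V, a ≤ p := fun a ha => hp ▸ Finset.le_max' _ a ha
    have hip := hle i hi
    obtain ⟨s, hs⟩ : ∃ s, s = V.min' ⟨i, hi⟩ := ⟨_, rfl⟩
    have hsm : s ∈ V := hs ▸ Finset.min'_mem _ _
    have hsmin : ∀ a ∈ V, s ≤ a := fun a ha => hs ▸ Finset.min'_le _ a ha
    have hsi := hsmin i hi
    obtain ⟨q, hq⟩ := exists_even_index (t := 2 * (s : ℕ)) (n := n) (by omega) (by omega)
      (by omega)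
    refine hrel p q _ hq hip (hlt p hpm) (by omega) ?_
    intro U hU a ha b hb
    by_cases hUV : V = U
    · subst hUV
      have h1 := hle a ha
      have h2 := hle b hb
      have h3 := hsmin a ha
      have h4 := hsmin b hb
      omega
    · have hnm : ∀ c ∈ U, c ≠ p ∧ c ≠ s := fun c hc =>
        ⟨fun e => hUV (π.eq_of_mem_parts hV hU hpm (e ▸ hc)),
          fun e => hUV (π.eq_of_mem_parts hV hU hsm (e ▸ hc))⟩
      have h1 := h.between hV hU hUV hsm hpm ha hb
      have h2 := h.between hV hU hUV hsm hpm hb ha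
      have h3 := hnm a ha
      have h4 := hnm b hb
      omega

/-- Non-crossing of opposite parities and maximality for gaps are built into the complement.
Maximality for letters is the substantial part, supplied by `NonCrossing.mem_of_not_separated`. -/
theorem isPlanar_toPlanar {n : ℕ} (hn : 0 < n) {π : Partn n} (h : NonCrossing π.parts) :
    IsPlanar 0 (2 * n) (toPlanar π) := by
  constructor
  · intro V hV
    replace hV := mem_toPlanar.1 hV
    rcases hV with ⟨V, hV, rfl⟩ | ⟨V, hV, rfl⟩
    · obtain ⟨i, hi⟩ := π.nonempty_of_mem_parts hV
      exact ⟨_, mem_oddBlock.2 ⟨i, hi, rfl⟩⟩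
    · obtain ⟨i, hi⟩ := (kreweras π).nonempty_of_mem_parts hV
      exact ⟨_, mem_evenBlock.2 ⟨i, hi, Or.inl rfl⟩⟩
  · intro V hV x hx
    replace hV := mem_toPlanar.1 hV
    rcases hV with ⟨V, hV, rfl⟩ | ⟨V, hV, rfl⟩
    · obtain ⟨i, hi, rfl⟩ := mem_oddBlock.1 hx
      omega
    · obtain ⟨i, hi, h⟩ := mem_evenBlock.1 hx
      omega
  · intro x _ hx
    by_cases hp : x % 2 = 0
    · obtain ⟨i, hi⟩ := exists_even_index hn hx hp
      obtain ⟨V, hV, hiV⟩ := Finpartition.exists_block (kreweras π) i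
      exact ⟨_, mem_toPlanar.2 (Or.inr ⟨V, hV, rfl⟩), mem_evenBlock.2 ⟨i, hiV, hi⟩⟩
    · obtain ⟨V, hV, hiV⟩ := Finpartition.exists_block π ⟨x / 2, by omega⟩
      exact ⟨_, mem_toPlanar.2 (Or.inl ⟨V, hV, rfl⟩), mem_oddBlock.2 ⟨_, hiV, by simp; omega⟩⟩
  · intro V hV W hW x hx hx'
    replace hV := mem_toPlanar.1 hV
    replace hW := mem_toPlanar.1 hW
    rcases hV with ⟨V, hV, rfl⟩ | ⟨V, hV, rfl⟩ <;> rcases hW with ⟨W, hW, rfl⟩ | ⟨W, hW, rfl⟩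
    · obtain ⟨i, hi, h1⟩ := mem_oddBlock.1 hx
      obtain ⟨j, hj, h2⟩ := mem_oddBlock.1 hx'
      obtain rfl : i = j := by omega
      rw [π.eq_of_mem_parts hV hW hi hj]
    · obtain ⟨i, hi, h1⟩ := mem_oddBlock.1 hx
      obtain ⟨j, hj, h2⟩ := mem_evenBlock.1 hx'
      omega
    · obtain ⟨i, hi, h1⟩ := mem_evenBlock.1 hx
      obtain ⟨j, hj, h2⟩ := mem_oddBlock.1 hx'
      omega
    · obtain ⟨i, hi, h1⟩ := mem_evenBlock.1 hx
      obtain ⟨j, hj, h2⟩ := mem_evenBlock.1 hx'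
      obtain rfl : i = j := by omega
      rw [(kreweras π).eq_of_mem_parts hV hW hi hj]
  · intro V hV x hx y hy
    replace hV := mem_toPlanar.1 hV
    rcases hV with ⟨V, hV, rfl⟩ | ⟨V, hV, rfl⟩
    · obtain ⟨i, hi, h1⟩ := mem_oddBlock.1 hx
      obtain ⟨j, hj, h2⟩ := mem_oddBlock.1 hy
      omega
    · obtain ⟨i, hi, h1⟩ := mem_evenBlock.1 hx
      obtain ⟨j, hj, h2⟩ := mem_evenBlock.1 hy
      omega
  · intro V hV W hW x hx y hy u hu v hv hup h1 h2
    replace hV := mem_toPlanar.1 hV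
    replace hW := mem_toPlanar.1 hW
    rcases hV with ⟨V, hV, rfl⟩ | ⟨V, hV, rfl⟩ <;> rcases hW with ⟨W, hW, rfl⟩ | ⟨W, hW, rfl⟩
    · obtain ⟨i, hi, rfl⟩ := mem_oddBlock.1 hx
      obtain ⟨j, hj, rfl⟩ := mem_oddBlock.1 hu
      omega
    · obtain ⟨i, hi, rfl⟩ := mem_oddBlock.1 hx
      obtain ⟨j, hj, rfl⟩ := mem_oddBlock.1 hy
      obtain ⟨k, hk, hu⟩ := mem_evenBlock.1 hu
      obtain ⟨l, hl, hv⟩ := mem_evenBlock.1 hv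
      have := (kreweras_mem_iff π k l).1 ⟨W, hW, hk, hl⟩ V hV i hi j hj
      omega
    · obtain ⟨i, hi, rfl⟩ := mem_oddBlock.1 hu
      obtain ⟨j, hj, rfl⟩ := mem_oddBlock.1 hv
      obtain ⟨k, hk, hx⟩ := mem_evenBlock.1 hx
      obtain ⟨l, hl, hy⟩ := mem_evenBlock.1 hy
      have := (kreweras_mem_iff π k l).1 ⟨V, hV, hk, hl⟩ W hW i hi j hj
      omega
    · obtain ⟨i, hi, hx⟩ := mem_evenBlock.1 hx
      obtain ⟨j, hj, hu⟩ := mem_evenBlock.1 hu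
      omega
  · intro x y _ hxy hy hp hsep
    by_cases hx0 : x % 2 = 0
    · obtain ⟨i, hi⟩ := exists_even_index (t := x) hn (by omega) hx0
      obtain ⟨j, hj⟩ := exists_even_index (t := y) hn hy (by omega)
      have hr : ∀ V ∈ π.parts, ∀ a ∈ V, ∀ b ∈ V, ((i < a ↔ j < a) ↔ (i < b ↔ j < b)) := by
        intro V hV a ha b hb
        have hV' := mem_toPlanar.2 (Or.inl ⟨V, hV, rfl⟩)
        have ha' := mem_oddBlock.2 ⟨a, ha, rfl⟩
        have hb' := mem_oddBlock.2 ⟨b, hb, rfl⟩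
        have h1 := hsep _ hV' _ ha' _ hb' (by omega)
        have h2 := hsep _ hV' _ hb' _ ha' (by omega)
        omega
      obtain ⟨V, hV, hiV, hjV⟩ := (kreweras_mem_iff π i j).2 hr
      exact ⟨_, mem_toPlanar.2 (Or.inr ⟨V, hV, rfl⟩), mem_evenBlock.2 ⟨i, hiV, hi⟩,
        mem_evenBlock.2 ⟨j, hjV, hj⟩⟩
    · obtain ⟨i, hi⟩ : ∃ i : Fin n, x = 2 * (i : ℕ) + 1 := ⟨⟨x / 2, by omega⟩, by simp; omega⟩
      obtain ⟨j, hj⟩ : ∃ j : Fin n, y = 2 * (j : ℕ) + 1 := ⟨⟨y / 2, by omega⟩, by simp; omega⟩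
      subst hi hj
      obtain ⟨V, hV, hiV, hjV⟩ := h.mem_of_not_separated (i := i) (j := j) (by omega)
        fun W hW u hu v hv h1 h2 => by
          refine hsep _ (mem_toPlanar.2 (Or.inr ⟨W, hW, rfl⟩)) u hu v hv ?_ h1 h2
          obtain ⟨k, hk, hu⟩ := mem_evenBlock.1 hu
          omega
      exact ⟨_, mem_toPlanar.2 (Or.inl ⟨V, hV, rfl⟩), mem_oddBlock.2 ⟨i, hiV, rfl⟩,
        mem_oddBlock.2 ⟨j, hjV, rfl⟩⟩

/-- A planar partition is determined by its odd blocks. -/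
theorem IsPlanar.subset_of_odd {a b : ℕ} {R R' : Finset (Finset ℕ)} (h : IsPlanar a b R)
    (h' : IsPlanar a b R') (hR : ∀ V ∈ R, ∀ v ∈ V, v % 2 = 1 → V ∈ R')
    (hR' : ∀ V ∈ R', ∀ v ∈ V, v % 2 = 1 → V ∈ R) : R ⊆ R' := by
  -- Two even points joined in `R` are not separated by any odd block of `R'`, as these all belong
  -- to `R`; maximality of `R'` joins them there too.
  have key : ∀ {R R' : Finset (Finset ℕ)}, IsPlanar a b R → IsPlanar a b R' →
      (∀ V ∈ R', ∀ v ∈ V, v % 2 = 1 → V ∈ R) → ∀ V ∈ R, ∀ W ∈ R', ∀ x, x ∈ V → x ∈ W →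
      x % 2 = 0 → V ⊆ W := by
    intro R R' h h' hR' V hV W hW x hxV hxW hx y hy
    have hyp := h.parity V hV x hxV y hy
    have hb := h.bounds V hV x hxV
    have hb' := h.bounds V hV y hy
    rcases lt_trichotomy x y with hxy | rfl | hxy
    · obtain ⟨U, hU, hxU, hyU⟩ := h'.maximal x y hb.1 hxy hb'.2 hyp
        fun Z hZ u hu v hv hup h1 h2 =>
          h.noncross V hV Z (hR' Z hZ u hu (by omega)) x hxV y hy u hu v hv hup h1 h2
      rwa [h'.eq_of_mem W hW U hU x hxW hxU]
    · exact hxW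
    · obtain ⟨U, hU, hyU, hxU⟩ := h'.maximal y x hb'.1 hxy hb.2 hyp.symm
        fun Z hZ u hu v hv hup h1 h2 =>
          h.noncross V hV Z (hR' Z hZ u hu (by omega)) y hy x hxV u hu v hv hup h1 h2
      rwa [h'.eq_of_mem W hW U hU x hxW hxU]
  intro V hV
  obtain ⟨x, hx⟩ := h.nonempty V hV
  by_cases hp : x % 2 = 1
  · exact hR V hV x hx hp
  · have hb := h.bounds V hV x hx
    obtain ⟨W, hW, hxW⟩ := h'.cover x hb.1 hb.2
    have : V = W := (key h h' hR' V hV W hW x hx hxW (by omega)).antisymm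
      (key h' h hR W hW V hV x hxW hx (by omega))
    rwa [this]

theorem toPlanar_injective {n : ℕ} : Function.Injective (toPlanar : Partn n → _) := by
  have key : ∀ π π' : Partn n, toPlanar π = toPlanar π' → π.parts ⊆ π'.parts := by
    intro π π' h V hV
    have hV' : oddBlock V ∈ toPlanar π' := h ▸ mem_toPlanar.2 (Or.inl ⟨V, hV, rfl⟩)
    rcases mem_toPlanar.1 hV' with ⟨W, hW, e⟩ | ⟨W, hW, e⟩
    · rwa [← oddBlock_injective e]
    · exfalso
      obtain ⟨i, hi⟩ := π.nonempty_of_mem_parts hV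
      have hi' := mem_oddBlock.2 ⟨i, hi, rfl⟩
      rw [← e] at hi'
      obtain ⟨j, hj, h⟩ := mem_evenBlock.1 hi'
      omega
  exact fun π π' h => Finpartition.ext ((key π π' h).antisymm (key π' π h.symm))

/-- Take the odd blocks of `R` as `π`. Then `toPlanar π` and `R` have the same odd blocks and hence
coincide, so the even blocks need not be examined. -/
theorem exists_toPlanar {n : ℕ} (hn : 0 < n) {R : Finset (Finset ℕ)}
    (h : IsPlanar 0 (2 * n) R) : ∃ π : Partn n, NonCrossing π.parts ∧ toPlanar π = R := by
  classical
  let s : Setoid (Fin n) :=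
    { r := fun i j => ∃ V ∈ R, 2 * (i : ℕ) + 1 ∈ V ∧ 2 * (j : ℕ) + 1 ∈ V
      iseqv := by
        refine ⟨fun i => ?_, fun {i j} => ?_, fun {i j k} => ?_⟩
        · obtain ⟨V, hV, hi⟩ := h.cover (2 * (i : ℕ) + 1) (by omega) (by omega)
          exact ⟨V, hV, hi, hi⟩
        · rintro ⟨V, hV, hi, hj⟩
          exact ⟨V, hV, hj, hi⟩
        · rintro ⟨V, hV, hi, hj⟩ ⟨W, hW, hj', hk⟩
          rw [h.eq_of_mem V hV W hW _ hj hj'] at hi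
          exact ⟨W, hW, hi, hk⟩ }
  let π : Partn n := Finpartition.ofSetoid s
  have hπ : ∀ i j, j ∈ π.part i ↔ ∃ V ∈ R, 2 * (i : ℕ) + 1 ∈ V ∧ 2 * (j : ℕ) + 1 ∈ V :=
    fun i j => Finpartition.mem_part_ofSetoid_iff_rel
  have hblock : ∀ i : Fin n, ∀ V ∈ R, 2 * (i : ℕ) + 1 ∈ V → oddBlock (π.part i) = V := by
    intro i V hV hi
    ext t
    rw [mem_oddBlock]
    constructor
    · rintro ⟨j, hj, rfl⟩
      obtain ⟨W, hW, hi', hj'⟩ := (hπ i j).1 hj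
      rwa [h.eq_of_mem V hV W hW _ hi hi']
    · intro ht
      have h1 := h.parity V hV _ ht _ hi
      have h2 := h.bounds V hV t ht
      have e : t = 2 * (t / 2) + 1 := by omega
      refine ⟨⟨t / 2, by omega⟩, (hπ _ _).2 ⟨V, hV, hi, ?_⟩, e⟩
      rw [e] at ht
      exact ht
  have hpart : ∀ V ∈ π.parts, oddBlock V ∈ R := by
    intro V hV
    obtain ⟨i, hi⟩ := π.nonempty_of_mem_parts hV
    obtain ⟨W, hW, hiW⟩ := h.cover (2 * (i : ℕ) + 1) (by omega) (by omega)
    rw [← π.part_eq_of_mem hV hi, hblock i W hW hiW]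
    exact hW
  have hnc : NonCrossing π.parts := by
    intro V hV W hW a b c d hab hbc hcd ha hc hb hd
    refine oddBlock_injective (h.not_cross (hpart V hV) (hpart W hW)
      (mem_oddBlock.2 ⟨a, ha, rfl⟩) (mem_oddBlock.2 ⟨c, hc, rfl⟩) (mem_oddBlock.2 ⟨b, hb, rfl⟩)
      (mem_oddBlock.2 ⟨d, hd, rfl⟩) ?_ ?_ ?_) <;> omega
  have hpl := isPlanar_toPlanar hn hnc
  have h1 : ∀ V ∈ toPlanar π, ∀ v ∈ V, v % 2 = 1 → V ∈ R := by
    intro V hV v hv hvp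
    replace hV := mem_toPlanar.1 hV
    rcases hV with ⟨V, hV, rfl⟩ | ⟨V, hV, rfl⟩
    · exact hpart V hV
    · obtain ⟨i, hi, h⟩ := mem_evenBlock.1 hv
      omega
  have h2 : ∀ V ∈ R, ∀ v ∈ V, v % 2 = 1 → V ∈ toPlanar π := by
    intro V hV v hv hvp
    have hb := h.bounds V hV v hv
    have e : v = 2 * (v / 2) + 1 := by omega
    have := hblock ⟨v / 2, by omega⟩ V hV (by rw [e] at hv; exact hv)
    rw [← this]
    exact mem_toPlanar.2 (Or.inl ⟨_, π.part_mem.2 (Finset.mem_univ _), rfl⟩)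
  exact ⟨π, hnc, (hpl.subset_of_odd h h1 h2).antisymm (h.subset_of_odd hpl h2 h1)⟩

/-! ### The sum over non-crossing partitions -/

section NoncrossingSums

variable {X : Type*}

/-- The restriction of the word `y` to the positions in `V`. -/
def subword {n : ℕ} (y : Fin n → X) (V : Finset (Fin n)) : List X := (V.sort (· ≤ ·)).map y

theorem pick_image {n : ℕ} (y : Fin n → X) (x : ℕ → X) (hx : ∀ i : Fin n, x i = y i)
    (e : ℕ → ℕ) (V : Finset (Fin n)) (U : Finset ℕ) (hU : ∀ i : Fin n, e i ∈ U ↔ i ∈ V) :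
    pick n x e U = subword y V := by
  have h : (Finset.range n).filter (fun i => e i ∈ U) = V.map Fin.valEmbedding := by
    ext i
    simp only [Finset.mem_filter, Finset.mem_range, Finset.mem_map, Fin.valEmbedding_apply]
    constructor
    · rintro ⟨hi, h⟩
      exact ⟨⟨i, hi⟩, (hU ⟨i, hi⟩).1 h, rfl⟩
    · rintro ⟨j, hj, rfl⟩
      exact ⟨j.2, (hU j).2 hj⟩
  have h2 : (V.map Fin.valEmbedding).sort (· ≤ ·) = (V.sort (· ≤ ·)).map Fin.val := by
    refine (StrictMonoOn.map_finsetSort (f := Fin.valEmbedding) (s := V) ?_).symm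
    exact fun a _ b _ h => h
  rw [pick, h, h2, List.map_map, subword]
  exact List.map_congr_left fun i _ => hx i

open Classical in
/-- The boxed convolution of words is a sum over non-crossing partitions. -/
theorem sum_noncrossing_eq_box (F G : WordFn X) {n : ℕ} (hn : 0 < n) (y : Fin n → X) :
    ∑ π ∈ (Finset.univ : Finset (Partn n)).filter (fun π => NonCrossing π.parts),
      (∏ V ∈ π.parts, eval F (subword y V)) *
        ∏ W ∈ (kreweras π).parts, eval G (subword y W) = eval (box F G) (List.ofFn y) := by
  obtain ⟨n, rfl⟩ : ∃ m, n = m + 1 := ⟨n - 1, by omega⟩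
  -- The padding value beyond the word is never read.
  let x : ℕ → X := fun i => if h : i < n + 1 then y ⟨i, h⟩ else y 0
  have hx : ∀ i : Fin (n + 1), x i = y i := fun i => dif_pos i.2
  have hlist : List.ofFn y = x 0 :: seg x 1 n := by
    have h : List.ofFn y = (List.range (n + 1)).map x := by
      refine List.ext_getElem (by simp) fun i h1 h2 => ?_
      have hi : i < n + 1 := by simpa using h1
      rw [List.getElem_ofFn, List.getElem_map, List.getElem_range]
      exact (hx ⟨i, hi⟩).symm
    rw [h, List.range_eq_range', List.range'_succ]
    rfl
  rw [hlist]
  refine Eq.trans ?_ (planarSum_blockWeight F G n x)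
  rw [planarSum]
  refine Finset.sum_bij (fun π _ => toPlanar π) ?_ ?_ ?_ ?_
  · intro π hπ
    exact mem_planarPartitions.2 (isPlanar_toPlanar (Nat.succ_pos n) (Finset.mem_filter.1 hπ).2)
  · exact fun π _ π' _ h => toPlanar_injective h
  · intro R hR
    obtain ⟨π, hπ, rfl⟩ := exists_toPlanar (Nat.succ_pos n) (mem_planarPartitions.1 hR)
    exact ⟨π, Finset.mem_filter.2 ⟨Finset.mem_univ _, hπ⟩, rfl⟩
  · intro π hπ
    rw [toPlanar, Finset.prod_union, Finset.prod_image fun _ _ _ _ h => oddBlock_injective h,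
      Finset.prod_image fun _ _ _ _ h => evenBlock_injective h]
    · congr 1
      · refine Finset.prod_congr rfl fun V hV => ?_
        obtain ⟨i, hi⟩ := π.nonempty_of_mem_parts hV
        rw [blockWeight, if_pos ⟨_, mem_oddBlock.2 ⟨i, hi, rfl⟩, by omega⟩,
          pick_image y x hx oddPt V]
        intro i
        rw [mem_oddBlock]
        constructor
        · rintro ⟨j, hj, h⟩
          have : i = j := by unfold oddPt at h; omega
          rwa [this]
        · exact fun hi => ⟨i, hi, rfl⟩
      · refine Finset.prod_congr rfl fun V hV => ?_
        rw [blockWeight, if_neg, pick_image y x hx evenPt V]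
        · exact fun i => evenPt_mem_evenBlock
        · rintro ⟨v, hv, hp⟩
          obtain ⟨i, hi, h⟩ := mem_evenBlock.1 hv
          omega
    · rw [Finset.disjoint_left]
      intro U hU hU'
      obtain ⟨V, hV, rfl⟩ := Finset.mem_image.1 hU
      obtain ⟨W, hW, e⟩ := Finset.mem_image.1 hU'
      obtain ⟨i, hi⟩ := π.nonempty_of_mem_parts hV
      have hi' := mem_oddBlock.2 ⟨i, hi, rfl⟩
      rw [← e] at hi'
      obtain ⟨j, hj, h⟩ := mem_evenBlock.1 hi'
      omega

end NoncrossingSums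

/-! ### Interval partitions -/

namespace WordFn

variable {X : Type*}

/-- The comparisons below hold only on certain words, so equalities have to be localized to the
subwords a product actually reads. -/
theorem conv_congr {φ φ' ψ ψ' : WordFn X} {x : X} {t : List X}
    (hφ : ∀ s, s <+: t → φ x s = φ' x s)
    (hψ : ∀ z r, (z :: r) <:+ (x :: t) → ψ z r = ψ' z r) : conv φ ψ x t = conv φ' ψ' x t := by
  induction t generalizing φ φ' x with
  | nil => rw [conv_nil, conv_nil, hφ _ (List.nil_prefix), hψ _ _ (List.suffix_refl _)]
  | cons y r ih =>
    rw [conv_cons, conv_cons, hφ _ (List.nil_prefix), hψ _ _ (List.suffix_refl _), ih]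
    · exact fun s hs => hφ _ (List.cons_prefix_cons.2 ⟨rfl, hs⟩)
    · exact fun z r' h => hψ _ _ (h.trans (List.suffix_cons _ _))

/-- If the right factor vanishes on letters, only proper prefixes matter on the left. -/
theorem conv_congr_of_nil {φ φ' ψ ψ' : WordFn X} {x : X} {t : List X}
    (h0 : ∀ x, ψ x [] = 0) (h0' : ∀ x, ψ' x [] = 0)
    (hφ : ∀ s, s <+: t → s.length < t.length → φ x s = φ' x s)
    (hψ : ∀ z r, (z :: r) <:+ (x :: t) → ψ z r = ψ' z r) : conv φ ψ x t = conv φ' ψ' x t := by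
  induction t generalizing φ φ' x with
  | nil => rw [conv_nil, conv_nil, h0, h0', mul_zero, mul_zero]
  | cons y r ih =>
    rw [conv_cons, conv_cons, hφ _ (List.nil_prefix) (by simp), hψ _ _ (List.suffix_refl _), ih]
    · exact fun s hs hl => hφ _ (List.cons_prefix_cons.2 ⟨rfl, hs⟩) (by simpa using hl)
    · exact fun z r' h => hψ _ _ (h.trans (List.suffix_cons _ _))

theorem two_conv_congr {ψ ψ' : WordFn X} {x : X} {t : List X}
    (h : ∀ z r, (z :: r) <:+: (x :: t) → ψ z r = ψ' z r) :
    conv two ψ x t = conv two ψ' x t := by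
  cases t with
  | nil => rw [two_conv_nil, two_conv_nil]
  | cons y r =>
    have := h y r (List.suffix_cons _ _).isInfix
    rwa [← shift_two_conv ψ x, ← shift_two_conv ψ' x] at this

theorem subst_congr {φ L L' : WordFn X} {x : X} {t : List X}
    (h : ∀ z r, (z :: r) <:+: (x :: t) → L z r = L' z r) :
    subst φ L x t = subst φ L' x t := by
  obtain ⟨n, hn⟩ : ∃ n, t.length ≤ n := ⟨_, le_rfl⟩
  induction n generalizing φ x t with
  | zero => rw [List.length_eq_zero_iff.1 (Nat.le_zero.1 hn)]; rfl
  | succ n ih =>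
    cases t with
    | nil => rfl
    | cons y r =>
      rw [subst_cons, subst_cons]
      refine conv_congr (fun s hs => ?_) fun z r' hr' => ?_
      · exact h x (y :: s) (List.IsPrefix.isInfix (by simpa using hs))
      · refine ih (fun w u hu => h w u ?_) ?_
        · exact hu.trans (hr'.trans (List.suffix_cons _ _)).isInfix
        · have := hr'.length_le
          simp only [List.length_cons] at this hn
          omega

theorem conv_two_concat (φ : WordFn X) (x : X) (s : List X) (a : X) :
    conv φ two x (s ++ [a]) = φ x s := by
  induction s generalizing φ x with
  | nil => simp [conv_cons, conv_nil, two]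
  | cons y r ih =>
    rw [List.cons_append, conv_cons, ih]
    simp [two, shift]

open Classical in
/-- The indicator of the one-letter word `z`. -/
noncomputable def letter (z : X) : WordFn X := fun x t => if t = [] ∧ x = z then 1 else 0

theorem subst_letter (z : X) (L : WordFn X) : subst (letter z) L = letter z := by
  funext x t
  cases t with
  | nil => rfl
  | cons y r =>
    have h : shift x (letter z) = 0 := by funext u v; simp [shift, letter]
    have h1 : subst (0 : WordFn X) L = 0 := by simpa using subst_smul 0 0 L
    have h2 : conv (shift x L) 0 = 0 := by simpa using conv_smul_right 0 (shift x L) 0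
    rw [subst_cons, h, h1, h2]
    simp [letter]

open Classical in
theorem conv_letter (φ : WordFn X) (z x : X) (t : List X) :
    conv φ (letter z) x t = if (x :: t).getLast (by simp) = z then φ x t else 0 := by
  induction t generalizing φ x with
  | nil => by_cases h : x = z <;> simp [conv_nil, letter, h]
  | cons y r ih =>
    rw [conv_cons, ih]
    simp [letter, shift]

/-- The indicator of the words of length one and of the words ending with `z`. -/
noncomputable def endsWith (z : X) : WordFn X :=
  conv zeta (letter z) + (one + (-1 : ℂ) • letter z)

open Classical in
theorem endsWith_apply (z x : X) (t : List X) : endsWith z x t =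
    if t = [] ∨ (x :: t).getLast (by simp) = z then 1 else 0 := by
  simp only [endsWith, Pi.add_apply, Pi.smul_apply, conv_letter, one, letter, zeta]
  rcases t with _ | ⟨y, r⟩
  · by_cases h : x = z <;> simp [h]
  · simp

/-- Substitution is multiplicative and fixes `letter z`, so it acts only on the factor `zeta`. -/
theorem planarSnd_endsWith (F : WordFn X) (z : X) :
    planarSnd F (endsWith z) = conv (subst zeta (conv two (planarFst F (endsWith z)))) (letter z) +
      (one + (-1 : ℂ) • letter z) := by
  rw [planarSnd, endsWith, subst_add, subst_add, subst_conv, subst_one, subst_smul, subst_letter]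

/-- The generating function of interval partitions. -/
noncomputable def intervalSum (F : WordFn X) : WordFn X := conv F (subst zeta (conv two F))

/-- Split off the first interval. This is the recursion of `box_zeta`, which makes the two kinds of
cumulants comparable. -/
theorem intervalSum_eq (F : WordFn X) :
    intervalSum F = F + conv F (conv two (intervalSum F)) := by
  conv_lhs => rw [intervalSum, subst_zeta (two_conv_nil _)]
  rw [conv_add_right, conv_one, conv_assoc two]
  rfl

/-- On words without repetition ending with `z`, the boxed convolution with `endsWith z` sums over
interval partitions. -/
theorem box_endsWith (F : WordFn X) {z x : X} {t : List X} (hnd : (x :: t).Nodup)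
    (hz : (x :: t).getLast (by simp) = z) : box F (endsWith z) x t = intervalSum F x t := by
  classical
  -- Without repetitions `z` occurs only at the very end, so no infix with a letter after it can end
  -- in `z`.
  have hfree : ∀ w s b, (w :: (s ++ [b])) <:+: (x :: t) → (w :: s).getLast (by simp) ≠ z := by
    intro w s b hs he
    obtain ⟨p, q, hpq⟩ := hs
    have hzm : z ∈ w :: s := he ▸ List.getLast_mem _
    have hzq : z ∈ [b] ++ q := by
      have : (x :: t).getLast (by simp) = ([b] ++ q).getLast (by simp) := by
        simp only [← hpq, ← List.cons_append, List.append_assoc]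
        rw [List.getLast_append_of_ne_nil _ (by simp), List.getLast_append_of_ne_nil _ (by simp)]
      rw [← hz, this]
      exact List.getLast_mem _
    rw [← hpq, show p ++ w :: (s ++ [b]) ++ q = p ++ ((w :: s) ++ ([b] ++ q)) by simp] at hnd
    exact (List.disjoint_of_nodup_append (List.nodup_append'.1 hnd).2.1) hzm hzq
  -- The factor `two` removes the last letter before `planarSnd` is evaluated. On words not ending
  -- in `z`, `planarSnd` reduces to the unit.
  have hQ : ∀ w s, (w :: s) <:+: (x :: t) →
      conv (planarSnd F (endsWith z)) two w s = two w s := by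
    intro w s hs
    rcases List.eq_nil_or_concat s with rfl | ⟨s, b, rfl⟩
    · rw [conv_nil_eq_zero two_nil, two_nil]
    · rw [List.concat_eq_append] at hs ⊢
      have hne := hfree w s b hs
      have h2 : (two : WordFn X) w (s ++ [b]) = one w s := by
        conv_lhs => rw [← one_conv two]
        exact conv_two_concat _ _ _ _
      rw [conv_two_concat, h2, planarSnd_endsWith]
      simp only [Pi.add_apply, Pi.smul_apply, conv_letter, if_neg hne, zero_add]
      rw [letter, if_neg, smul_zero, add_zero]
      rintro ⟨rfl, rfl⟩
      exact hne rfl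
  -- Hence `P = F[Q N]` reduces to `F[N] = F` on every infix.
  have hP : ∀ w s, (w :: s) <:+: (x :: t) → planarFst F (endsWith z) w s = F w s := by
    intro w s hs
    rw [planarFst_eq, subst_congr (L' := two), subst_two_right]
    exact fun u v huv => hQ u v (huv.trans hs)
  rw [box, intervalSum]
  refine conv_congr (fun s hs => hP x s ?_) fun w s hs => ?_
  · exact List.IsPrefix.isInfix (by simpa using hs)
  · have hw : (w :: s).getLast (by simp) = z := by
      rw [← hz]
      obtain ⟨p, hp⟩ := hs
      simp only [← hp]
      rw [List.getLast_append_of_ne_nil _ (by simp)]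
    rw [planarSnd_endsWith]
    simp only [Pi.add_apply, Pi.smul_apply, conv_letter, if_pos hw]
    have h1 : one w s + (-1 : ℂ) • letter z w s = 0 := by
      rcases s with _ | ⟨b, s⟩
      · have : w = z := by simpa using hw
        simp [one, letter, this]
      · simp [one, letter]
    rw [h1, add_zero]
    refine subst_congr fun u v huv => two_conv_congr fun u' v' h => hP u' v' ?_
    exact h.trans (huv.trans hs.isInfix)

/-- `booleanize` is determined by moments. -/
theorem eq_of_moments {S : List X → Prop} (hS : ∀ l l', l' <:+: l → S l → S l')
    {P M P' M' : WordFn X} (h : M = P + conv P (conv two M)) (h' : M' = P' + conv P' (conv two M'))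
    (hM : ∀ x t, S (x :: t) → M x t = M' x t) (x : X) (t : List X) (ht : S (x :: t)) :
    P x t = P' x t := by
  obtain ⟨n, hn⟩ : ∃ n, t.length ≤ n := ⟨_, le_rfl⟩
  induction n using Nat.strong_induction_on generalizing t with
  | _ n ih =>
  have h1 : M x t = P x t + conv P (conv two M) x t := congrFun (congrFun h x) t
  have h2 : M' x t = P' x t + conv P' (conv two M') x t := congrFun (congrFun h' x) t
  have h3 : conv P (conv two M) x t = conv P' (conv two M') x t := by
    refine conv_congr_of_nil (two_conv_nil _) (two_conv_nil _) (fun s hs hl => ?_) fun z r hr => ?_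
    · refine ih s.length (by omega) s (hS _ _ ?_ ht) le_rfl
      exact List.IsPrefix.isInfix (by simpa using hs)
    · exact two_conv_congr fun w u hu => hM w u (hS _ _ (hu.trans hr.isInfix) ht)
  have h4 := hM x t ht
  rw [h1, h2, h3] at h4
  exact add_right_cancel h4

end WordFn

/-- The blocks of `π` are intervals of the linear order on `Fin n`. -/
def IsIntervalPartition {n : ℕ} (π : Partn n) : Prop :=
  ∀ V ∈ π.parts, ∀ i ∈ V, ∀ k ∈ V, ∀ j, i < j → j < k → j ∈ V

/-- Interval partitions are those for which all blocks of the complement which do not contain the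
last point are singletons. -/
theorem isIntervalPartition_iff {n : ℕ} {π : Partn n} (h : NonCrossing π.parts) {z : Fin n}
    (hz : (z : ℕ) + 1 = n) : IsIntervalPartition π ↔
      ∀ W ∈ (kreweras π).parts, W.card = 1 ∨ z ∈ W := by
  constructor
  · intro hi W hW
    by_contra! hcon
    obtain ⟨hc, hzW⟩ := hcon
    have hpos := Finset.card_pos.2 ((kreweras π).nonempty_of_mem_parts hW)
    obtain ⟨a, ha, b, hb, hab⟩ := Finset.one_lt_card.1 (show 1 < W.card by omega)
    obtain ⟨i, hiW, j, hjW, hij⟩ : ∃ i ∈ W, ∃ j ∈ W, i < j := by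
      rcases lt_or_gt_of_ne hab with h | h
      · exact ⟨a, ha, b, hb, h⟩
      · exact ⟨b, hb, a, ha, h⟩
    have hrel := (kreweras_mem_iff π i j).1 ⟨W, hW, hiW, hjW⟩
    -- An interval block straddling the gap after `j` contains both `j` and `j + 1`, and then
    -- separates the gaps after `i` and `j`. So no block straddles this gap, and it is related to
    -- the last one.
    have key : ∀ V ∈ π.parts, ∀ a ∈ V, ∀ b ∈ V, j < b → j < a := by
      intro V hV a ha b hb hjb
      by_contra haj
      have h1 : j ∈ V := by
        by_cases e : a = j
        · rwa [← e]
        · exact hi V hV a ha b hb j (by omega) hjb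
      have hjn : (j : ℕ) + 1 < n := by omega
      have h2 : (⟨j + 1, hjn⟩ : Fin n) ∈ V := by
        by_cases e : b = ⟨j + 1, hjn⟩
        · rwa [← e]
        · have : (b : ℕ) ≠ j + 1 := fun h => e (Fin.ext h)
          refine hi V hV j h1 b hb _ ?_ ?_ <;> simp only [Fin.lt_def] <;> omega
      have := hrel V hV j h1 _ h2
      simp only [Fin.lt_def] at this
      omega
    obtain ⟨U, hU, hjU, hzU⟩ := (kreweras_mem_iff π j z).2 fun V hV a ha b hb => by
      have h1 := key V hV a ha b hb
      have h2 := key V hV b hb a ha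
      omega
    rw [(kreweras π).eq_of_mem_parts hU hW hjU hjW] at hzU
    exact hzW hzU
  · intro hW V hV i hi k hk j hij hjk
    by_contra hj
    obtain ⟨p, hp, q, hq, -, hpj, hjq, hgap⟩ := exists_neighbours hi hk hij hjk hj
    have hr := h.rel_of_gap hV hp hq (r := ⟨(q : ℕ) - 1, by omega⟩) (by omega) (by simp; omega)
      hgap
    obtain ⟨W, hWm, hpW, hrW⟩ := (kreweras_mem_iff π _ _).2 hr
    -- The gaps after `p` and before `q` are distinct, as `j` lies between. Nor can their block
    -- contain the last gap, since `V` has the point `q` beyond `p` but also `p` itself.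
    rcases hW W hWm with hc | hzW
    · have := congrArg Fin.val (Finset.card_le_one.1 hc.le _ hpW _ hrW)
      simp at this
      omega
    · have := (kreweras_mem_iff π _ _).1 ⟨W, hWm, hpW, hzW⟩ V hV p hp q hq
      omega

section IntervalSums

variable {X : Type*}

theorem length_subword {n : ℕ} (y : Fin n → X) (V : Finset (Fin n)) :
    (subword y V).length = V.card := by
  simp [subword]

theorem subword_sublist {n : ℕ} (y : Fin n → X) (V : Finset (Fin n)) :
    (subword y V).Sublist (List.ofFn y) := by
  rw [List.ofFn_eq_map]
  refine List.Sublist.map y ?_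
  refine List.sublist_of_subperm_of_pairwise (r := (· ≤ ·)) ?_ (Finset.pairwise_sort _ _) ?_
  · exact (Finset.sort_nodup _ _).subperm fun i _ => List.mem_finRange i
  · exact (List.pairwise_le_finRange n)

open Classical in
theorem eval_endsWith_subword {n : ℕ} {y : Fin n → X} (hy : Function.Injective y) {z : Fin n}
    (hz : (z : ℕ) + 1 = n) {W : Finset (Fin n)} (hW : W.Nonempty) :
    eval (endsWith (y z)) (subword y W) = if W.card = 1 ∨ z ∈ W then 1 else 0 := by
  have hne : W.sort (· ≤ ·) ≠ [] := by
    intro h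
    have := Finset.length_sort (· ≤ ·) (s := W)
    rw [h] at this
    exact (Finset.card_pos.2 hW).ne this
  have hlast : (W.sort (· ≤ ·)).getLast hne = z ↔ z ∈ W := by
    constructor
    · intro h
      rw [← h]
      exact (Finset.mem_sort (· ≤ ·)).1 (List.getLast_mem _)
    · intro h
      have h1 := (Finset.pairwise_sort W (· ≤ ·)).rel_getLast ((Finset.mem_sort (· ≤ ·)).2 h)
      omega
  have hlen := length_subword y W
  have hlast' : ∀ h, (subword y W).getLast h = y z ↔ z ∈ W := fun h => by
    rw [← hlast]
    simp only [subword, List.getLast_map]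
    exact hy.eq_iff
  obtain ⟨a, t, ht⟩ := List.exists_cons_of_ne_nil
    (show subword y W ≠ [] by simpa [subword] using hne)
  simp only [ht] at hlen hlast' ⊢
  rw [eval, endsWith_apply]
  have h1 : t = [] ↔ W.card = 1 := by
    rw [← hlen, ← List.length_eq_zero_iff]
    simp
  have h2 := hlast' (by simp)
  simp only [h1, h2]

open Classical in
/-- The sum over interval partitions. -/
theorem sum_interval_eq (F : WordFn X) {n : ℕ} (hn : 0 < n) {y : Fin n → X}
    (hy : Function.Injective y) :
    ∑ π ∈ (Finset.univ : Finset (Partn n)).filter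
      (fun π => NonCrossing π.parts ∧ IsIntervalPartition π),
      ∏ V ∈ π.parts, eval F (subword y V) = eval (intervalSum F) (List.ofFn y) := by
  obtain ⟨n, rfl⟩ : ∃ m, n = m + 1 := ⟨n - 1, by omega⟩
  have hlist : List.ofFn y = y 0 :: List.ofFn (fun i : Fin n => y i.succ) := List.ofFn_succ
  have hz : ((Fin.last n : Fin (n + 1)) : ℕ) + 1 = n + 1 := rfl
  have hbox : eval (box F (endsWith (y (Fin.last n)))) (List.ofFn y) =
      eval (intervalSum F) (List.ofFn y) := by
    have hnd := List.nodup_ofFn.2 hy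
    have hl : ∀ h, (List.ofFn y).getLast h = y (Fin.last n) := fun h => by
      rw [List.getLast_ofFn]; rfl
    rw [hlist] at hnd ⊢
    refine box_endsWith F hnd ?_
    simp only [← hlist]
    exact hl _
  -- With the weight `endsWith` on the complement, the product over its blocks is the indicator of
  -- interval partitions, so the general non-crossing formula applies.
  rw [← hbox, ← sum_noncrossing_eq_box _ _ hn, ← Finset.filter_filter, Finset.sum_filter]
  refine Finset.sum_congr rfl fun π hπ => ?_
  have hπ := (Finset.mem_filter.1 hπ).2
  have h : ∏ W ∈ (kreweras π).parts, eval (endsWith (y (Fin.last n))) (subword y W) =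
      if IsIntervalPartition π then 1 else 0 := by
    rw [isIntervalPartition_iff hπ hz]
    rw [Finset.prod_congr rfl fun W hW =>
      eval_endsWith_subword hy hz ((kreweras π).nonempty_of_mem_parts hW), Finset.prod_boole]
    congr
  rw [h]
  split_ifs <;> simp

end IntervalSums

/-! ### From bi-non-crossing to non-crossing partitions -/

theorem Partn.permute_parts {n : ℕ} (s : Equiv.Perm (Fin n)) (π : Partn n) :
    (π.permute s).parts = π.parts.map s.finsetCongr.toEmbedding := rfl

theorem Partn.permute_permute {n : ℕ} (s t : Equiv.Perm (Fin n)) (π : Partn n) :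
    (π.permute s).permute t = π.permute (t * s) := by
  apply Finpartition.ext
  rw [permute_parts, permute_parts, permute_parts, Finset.map_map]
  congr 1
  ext V : 1
  simp [Finset.map_map]
  rfl

theorem Partn.permute_one {n : ℕ} (π : Partn n) : π.permute 1 = π := by
  apply Finpartition.ext
  change π.parts.map (Equiv.refl (Fin n)).finsetCongr.toEmbedding = _
  simp

theorem Partn.prod_permute {n : ℕ} (s : Equiv.Perm (Fin n)) (π : Partn n)
    (H : Finset (Fin n) → ℂ) :
    ∏ V ∈ (π.permute s).parts, H V = ∏ V ∈ π.parts, H (V.map s.toEmbedding) := by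
  rw [permute_parts, Finset.prod_map]
  rfl

theorem mem_BNC_permute {n : ℕ} (χ : Fin n → Face) (π : Partn n) :
    π.permute (sPerm χ) ∈ BNC χ ↔ NonCrossing π.parts := by
  simp only [BNC, Finset.mem_filter, Finset.mem_univ, true_and]
  rw [Partn.permute_permute, inv_mul_cancel, Partn.permute_one]

theorem mem_BI_permute {n : ℕ} (χ : Fin n → Face) (π : Partn n) :
    π.permute (sPerm χ) ∈ BI χ ↔ NonCrossing π.parts ∧ IsIntervalPartition π := by
  simp only [BI, Finset.mem_filter, mem_BNC_permute]
  refine and_congr_right fun _ => ?_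
  rw [Partn.permute_parts, Finset.forall_mem_map]
  refine forall₂_congr fun V _ => ?_
  have hs : ∀ i, (sPerm χ)⁻¹ (sPerm χ i) = i := fun i => (sPerm χ).symm_apply_apply i
  have hs' : ∀ i, sPerm χ ((sPerm χ)⁻¹ i) = i := fun i => (sPerm χ).apply_symm_apply i
  change IsChiInterval χ (V.map (sPerm χ).toEmbedding) ↔ _
  constructor
  · intro h i hi k hk j hij hjk
    have := h _ (Finset.mem_map_of_mem _ hi) _ (Finset.mem_map_of_mem _ hk) (sPerm χ j)
    simp only [Equiv.coe_toEmbedding, hs] at this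
    simpa using this hij hjk
  · intro h i hi k hk j hij hjk
    obtain ⟨i, hiV, rfl⟩ := Finset.mem_map.1 hi
    obtain ⟨k, hkV, rfl⟩ := Finset.mem_map.1 hk
    simp only [Equiv.coe_toEmbedding, hs] at hij hjk
    rw [← hs' j]
    exact Finset.mem_map_of_mem _ (h i hiV k hkV _ hij hjk)

theorem krewerasBNC_permute {n : ℕ} (χ : Fin n → Face) (π : Partn n) :
    krewerasBNC χ (π.permute (sPerm χ)) = (kreweras π).permute (sPerm χ) := by
  rw [krewerasBNC, Partn.permute_permute, inv_mul_cancel, Partn.permute_one]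

open Classical in
theorem sum_permute {n : ℕ} (s : Equiv.Perm (Fin n)) (S : Finset (Partn n)) (p : Partn n → Prop)
    (hS : ∀ π, π.permute s ∈ S ↔ p π) (H : Partn n → ℂ) :
    ∑ π ∈ S, H π = ∑ π ∈ (Finset.univ : Finset (Partn n)).filter p, H (π.permute s) := by
  have h1 : ∀ π : Partn n, (π.permute s⁻¹).permute s = π := fun π => by
    rw [Partn.permute_permute, mul_inv_cancel, Partn.permute_one]
  have h2 : ∀ π : Partn n, (π.permute s).permute s⁻¹ = π := fun π => by
    rw [Partn.permute_permute, inv_mul_cancel, Partn.permute_one]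
  refine Finset.sum_nbij' (fun π => π.permute s⁻¹) (fun π => π.permute s) ?_ ?_ ?_ ?_ ?_
  · intro π hπ
    exact Finset.mem_filter.2 ⟨Finset.mem_univ _, (hS _).1 (by rwa [h1])⟩
  · intro π hπ
    exact (hS π).2 (Finset.mem_filter.1 hπ).2
  · exact fun π _ => h1 π
  · exact fun π _ => h2 π
  · exact fun π _ => by rw [h1]

/-! ### Words of positions -/

section Positions

variable {X : Type*}

/-- The coefficients of the restrictions of `α`, as a function on words of positions. -/
noncomputable def NCSeries.wordFn (f : NCSeries X) {n : ℕ} (α : Fin n → X) : WordFn (Fin n) :=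
  fun x t => f.coeff _ (restr α (x :: t).toFinset)

theorem NCSeries.eval_wordFn (f : NCSeries X) {n : ℕ} (α : Fin n → X) (l : List (Fin n)) :
    eval (f.wordFn α) l = f.coeff _ (restr α l.toFinset) := by
  cases l with
  | nil => exact (f.coeff_zero _).symm
  | cons x t => rfl

theorem NCSeries.coeff_restr_map (f : NCSeries X) {m n : ℕ} (α : Fin n → X) (e : Fin m ↪o Fin n)
    (W : Finset (Fin m)) : f.coeff _ (restr (fun i => α (e i)) W) =
      f.coeff _ (restr α (W.map e.toEmbedding)) := by
  -- The length is generalized because the two coefficients have index types whose cardinalities are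
  -- equal only propositionally.
  have key : ∀ (k : ℕ) (h : (W.map e.toEmbedding).card = k),
      f.coeff _ (restr (fun i => α (e i)) W) =
        f.coeff k (fun i => α ((W.map e.toEmbedding).orderEmbOfFin h i)) := by
    intro k h
    obtain rfl : W.card = k := by simpa using h
    congr 1
    funext i
    have := Finset.orderEmbOfFin_unique h (f := fun i => e (W.orderEmbOfFin rfl i))
      (fun i => Finset.mem_map_of_mem _ (Finset.orderEmbOfFin_mem _ _ _))
      (fun i j hij => e.strictMono ((W.orderEmbOfFin rfl).strictMono hij))
    rw [← this]
    rfl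
  exact key _ rfl

theorem toFinset_subword {m : ℕ} {Y : Type*} [DecidableEq Y] (y : Fin m → Y)
    (V : Finset (Fin m)) : (subword y V).toFinset = V.image y := by
  ext a
  simp [subword]

/-- The order of positions: left before right, left increasing, right decreasing. -/
def FacePrec {n : ℕ} (χ : Fin n → Face) (i j : Fin n) : Prop :=
  (χ i = Face.left ∧ (χ j = Face.right ∨ i < j)) ∨
    (χ i = Face.right ∧ χ j = Face.right ∧ j < i)

theorem FacePrec.asymm {n : ℕ} {χ : Fin n → Face} {i j : Fin n} (h : FacePrec χ i j) :
    ¬ FacePrec χ j i := by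
  unfold FacePrec at *
  rintro h'
  cases hi : χ i <;> cases hj : χ j <;> simp [hi, hj] at h h'
  · exact absurd h h'.asymm
  · exact absurd h h'.asymm

theorem pairwise_chiList {n : ℕ} (χ : Fin n → Face) : (chiList χ).Pairwise (FacePrec χ) := by
  rw [chiList, List.pairwise_append]
  refine ⟨?_, ?_, ?_⟩
  · rw [List.pairwise_filter]
    refine (List.pairwise_lt_finRange n).imp fun {a b} h ha hb => ?_
    exact Or.inl ⟨by simpa using ha, Or.inr h⟩
  · rw [List.pairwise_reverse, List.pairwise_filter]
    refine (List.pairwise_lt_finRange n).imp fun {a b} h ha hb => ?_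
    exact Or.inr ⟨by simpa using hb, by simpa using ha, h⟩
  · intro a ha b hb
    simp at ha hb
    exact Or.inl ⟨ha, Or.inl hb⟩

theorem eq_of_pairwise_facePrec {n : ℕ} {χ : Fin n → Face} {l l' : List (Fin n)}
    (hl : l.Pairwise (FacePrec χ)) (hl' : l'.Pairwise (FacePrec χ)) (h : ∀ i, i ∈ l ↔ i ∈ l') :
    l = l' := by
  have hnd : ∀ {l : List (Fin n)}, l.Pairwise (FacePrec χ) → l.Nodup := fun hl =>
    hl.imp fun {a b} hab e => by
      subst e
      exact hab.asymm hab
  exact ((List.perm_ext_iff_of_nodup (hnd hl) (hnd hl')).2 h).eq_of_pairwise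
    (fun a b _ _ h1 h2 => absurd h2 h1.asymm) hl hl'

theorem ofFn_sPerm {n : ℕ} (χ : Fin n → Face) : List.ofFn (fun i => sPerm χ i) = chiList χ := by
  refine List.ext_getElem ?_ fun i h1 h2 => ?_
  · rw [List.length_ofFn]
    exact length_chiList χ
  · rw [List.getElem_ofFn]
    simp [sPerm]

end Positions

/-! ### The transforms and the convolution on words of positions -/

section TwoFaced

variable {I J : Type*}

/-- The positions in `V`, in the order `≺`. -/
def positions {n : ℕ} (α : Fin n → I ⊕ J) (V : Finset (Fin n)) (i : Fin V.card) : Fin n :=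
  V.orderEmbOfFin rfl (sPerm (chi (restr α V)) i)

theorem positions_injective {n : ℕ} (α : Fin n → I ⊕ J) (V : Finset (Fin n)) :
    Function.Injective (positions α V) :=
  (V.orderEmbOfFin rfl).injective.comp (sPerm _).injective

/-- The order which `χ` restricted to a subset defines there is the restriction of `≺`. So every set
of positions, listed by its own `s_χ`, is a `≺`-increasing word. -/
theorem ofFn_positions {n : ℕ} (α : Fin n → I ⊕ J) {l : List (Fin n)}
    (hl : l.Pairwise (FacePrec (chi α))) : List.ofFn (positions α l.toFinset) = l := by
  have h : List.ofFn (positions α l.toFinset) =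
      (chiList (chi (restr α l.toFinset))).map (l.toFinset.orderEmbOfFin rfl) := by
    rw [← ofFn_sPerm, List.map_ofFn]
    rfl
  rw [h]
  refine eq_of_pairwise_facePrec (χ := chi α) ?_ hl fun i => ?_
  · rw [List.pairwise_map]
    refine (pairwise_chiList _).imp fun {a b} hab => ?_
    rcases hab with ⟨h1, h2 | h2⟩ | ⟨h1, h2, h3⟩
    · exact Or.inl ⟨h1, Or.inl h2⟩
    · exact Or.inl ⟨h1, Or.inr ((l.toFinset.orderEmbOfFin rfl).strictMono h2)⟩
    · exact Or.inr ⟨h1, h2, (l.toFinset.orderEmbOfFin rfl).strictMono h3⟩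
  · have hr := Finset.range_orderEmbOfFin l.toFinset rfl
    rw [Set.ext_iff] at hr
    have := hr i
    simp only [Set.mem_range, List.coe_toFinset, Set.mem_ofPred_eq] at this
    rw [← this, List.mem_map]
    exact ⟨fun ⟨a, _, ha⟩ => ⟨a, ha⟩, fun ⟨a, ha⟩ => ⟨a, mem_chiList _ a, ha⟩⟩

/-- The coefficient of a block is read in the natural order and its word in the order `≺`; they
match because `wordFn` depends only on the set of positions. -/
theorem NCSeries.coeffPart_permute (f : NCSeries (I ⊕ J)) {n : ℕ} (α : Fin n → I ⊕ J)
    (V : Finset (Fin n)) (π : Partn V.card) :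
    f.coeffPart (restr α V) (π.permute (sPerm (chi (restr α V)))) =
      ∏ W ∈ π.parts, eval (f.wordFn α) (subword (positions α V) W) := by
  rw [coeffPart, Partn.prod_permute]
  refine Finset.prod_congr rfl fun W _ => ?_
  rw [eval_wordFn, toFinset_subword]
  refine (f.coeff_restr_map α (V.orderEmbOfFin rfl) _).trans ?_
  have : (W.map (sPerm (chi (restr α V))).toEmbedding).map (V.orderEmbOfFin rfl).toEmbedding =
      W.image (positions α V) := by
    rw [Finset.map_map, Finset.map_eq_image]
    rfl
  rw [this]

/-- A sum over bi-non-crossing partitions is a boxed convolution of words of positions. -/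
theorem sum_BNC_eq_box (f g : NCSeries (I ⊕ J)) {n : ℕ} (α : Fin n → I ⊕ J) {l : List (Fin n)}
    (hl : l.Pairwise (FacePrec (chi α))) (hne : l ≠ []) :
    ∑ π ∈ BNC (chi (restr α l.toFinset)), f.coeffPart (restr α l.toFinset) π *
      g.coeffPart (restr α l.toFinset) (krewerasBNC (chi (restr α l.toFinset)) π) =
      eval (box (f.wordFn α) (g.wordFn α)) l := by
  have hpos : 0 < l.toFinset.card := Finset.card_pos.2 (List.toFinset_nonempty_iff _ |>.2 hne)
  rw [sum_permute _ _ _ (mem_BNC_permute _)]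
  simp only [krewerasBNC_permute, NCSeries.coeffPart_permute]
  rw [sum_noncrossing_eq_box _ _ hpos, ofFn_positions α hl]

theorem wordFn_twistedBox (f g : NCSeries (I ⊕ J)) {n : ℕ} (α : Fin n → I ⊕ J)
    {l : List (Fin n)} (hl : l.Pairwise (FacePrec (chi α))) :
    eval ((f.twistedBox g).wordFn α) l = eval (box (f.wordFn α) (g.wordFn α)) l := by
  by_cases hne : l = []
  · rw [hne]; rfl
  rw [← sum_BNC_eq_box f g α hl hne, NCSeries.eval_wordFn]
  refine if_neg fun h => hne ?_
  rwa [Finset.card_eq_zero, List.toFinset_eq_empty_iff] at h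

theorem eval_zeta_subword {n : ℕ} {Y : Type*} (y : Fin n → Y) {V : Finset (Fin n)}
    (hV : V.Nonempty) : eval zeta (subword y V) = 1 := by
  cases h : subword y V with
  | nil =>
    have := length_subword y V
    rw [h] at this
    exact absurd (Finset.card_pos.2 hV) (by simp at this; simp [← this])
  | cons a t => rfl

theorem sum_BNC_eq_box_zeta (f : NCSeries (I ⊕ J)) {n : ℕ} (α : Fin n → I ⊕ J)
    {l : List (Fin n)} (hl : l.Pairwise (FacePrec (chi α))) (hne : l ≠ []) :
    ∑ π ∈ BNC (chi (restr α l.toFinset)), f.coeffPart (restr α l.toFinset) π =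
      eval (box (f.wordFn α) zeta) l := by
  have hpos : 0 < l.toFinset.card := Finset.card_pos.2 (List.toFinset_nonempty_iff _ |>.2 hne)
  rw [sum_permute _ _ _ (mem_BNC_permute _)]
  simp only [NCSeries.coeffPart_permute]
  have h := sum_noncrossing_eq_box (f.wordFn α) zeta hpos (positions α l.toFinset)
  rw [ofFn_positions α hl] at h
  rw [← h]
  refine Finset.sum_congr rfl fun π _ => ?_
  rw [Finset.prod_eq_one fun W hW =>
    eval_zeta_subword _ ((kreweras π).nonempty_of_mem_parts hW), mul_one]

theorem sum_BI_eq_intervalSum (f : NCSeries (I ⊕ J)) {n : ℕ} (α : Fin n → I ⊕ J)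
    {l : List (Fin n)} (hl : l.Pairwise (FacePrec (chi α))) (hne : l ≠ []) :
    ∑ π ∈ BI (chi (restr α l.toFinset)), f.coeffPart (restr α l.toFinset) π =
      eval (intervalSum (f.wordFn α)) l := by
  have hpos : 0 < l.toFinset.card := Finset.card_pos.2 (List.toFinset_nonempty_iff _ |>.2 hne)
  rw [sum_permute _ _ _ (mem_BI_permute _)]
  simp only [NCSeries.coeffPart_permute]
  have h := sum_interval_eq (f.wordFn α) hpos (positions_injective α l.toFinset)
  rw [ofFn_positions α hl] at h
  convert h

/-- `bReta` is characterized by the equality of moments. -/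
theorem sum_BNC_eq_sum_BI (f : NCSeries (I ⊕ J)) {n : ℕ} (hn : 0 < n) (α : Fin n → I ⊕ J) :
    ∑ π ∈ BNC (chi α), f.coeffPart α π = ∑ π ∈ BI (chi α), (bReta f).coeffPart α π := by
  obtain ⟨μ, rfl⟩ := rMap_bijective.2 f
  have hη : bReta (rMap μ) = etaMap μ := by
    rw [bReta, Equiv.trans_apply]
    have : (Equiv.ofBijective rMap rMap_bijective).symm (rMap μ) = μ :=
      (Equiv.ofBijective rMap rMap_bijective).symm_apply_apply μ
    rw [this]
    rfl
  rw [hη]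
  have h1 := moment_eq_sum_cumulant μ.1 BNC hn (chi α) (top_mem_BNC _)
    (fun k => FreeAlgebra.ι ℂ (α k))
  have h2 := moment_eq_sum_cumulant μ.1 BI hn (chi α) (top_mem_BI _)
    (fun k => FreeAlgebra.ι ℂ (α k))
  refine Eq.trans ?_ (h1.symm.trans (h2.trans ?_))
  · refine Finset.sum_congr rfl fun π _ => Finset.prod_congr rfl fun V hV => ?_
    exact if_neg (Finset.card_pos.2 (π.nonempty_of_mem_parts hV)).ne'
  · refine Finset.sum_congr rfl fun π _ => Finset.prod_congr rfl fun V hV => ?_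
    exact (if_neg (Finset.card_pos.2 (π.nonempty_of_mem_parts hV)).ne').symm

/-- Both sides are first factors in the recursion `M = P + P N M`, and their moments agree on all
`≺`-increasing words. -/
theorem wordFn_bReta (f : NCSeries (I ⊕ J)) {n : ℕ} (α : Fin n → I ⊕ J) {l : List (Fin n)}
    (hl : l.Pairwise (FacePrec (chi α))) :
    eval ((bReta f).wordFn α) l = eval (booleanize (f.wordFn α)) l := by
  cases l with
  | nil => rfl
  | cons x t =>
    change (bReta f).wordFn α x t = booleanize (f.wordFn α) x t
    refine eq_of_moments (S := fun l => l.Pairwise (FacePrec (chi α)))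
      (fun l l' h hl => hl.sublist h.sublist) (intervalSum_eq _) (box_zeta _) ?_ x t hl
    intro x t h
    have hne : x :: t ≠ [] := by simp
    have h1 := sum_BNC_eq_box_zeta f α h hne
    have h2 := sum_BI_eq_intervalSum (bReta f) α h hne
    rw [← sum_BNC_eq_sum_BI f (Finset.card_pos.2 (List.toFinset_nonempty_iff _ |>.2 hne))] at h2
    exact h2.symm.trans h1

/-- The expansion over non-crossing partitions evaluates the factors only on subwords. -/
theorem box_congr {Y : Type*} {F F' G G' : WordFn Y} {l : List Y}
    (hF : ∀ l', l'.Sublist l → eval F l' = eval F' l')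
    (hG : ∀ l', l'.Sublist l → eval G l' = eval G' l') :
    eval (box F G) l = eval (box F' G') l := by
  classical
  rcases Nat.eq_zero_or_pos l.length with h0 | h0
  · rw [List.length_eq_zero_iff.1 h0]; rfl
  have hs : ∀ V, (subword l.get V).Sublist l := fun V => by
    have := subword_sublist l.get V
    rwa [List.ofFn_get] at this
  have h1 := sum_noncrossing_eq_box F G h0 l.get
  have h2 := sum_noncrossing_eq_box F' G' h0 l.get
  rw [List.ofFn_get] at h1 h2
  rw [← h1, ← h2]
  refine Finset.sum_congr rfl fun π _ => ?_
  congr 1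
  · exact Finset.prod_congr rfl fun V _ => hF _ (hs V)
  · exact Finset.prod_congr rfl fun V _ => hG _ (hs V)

/-- Locality of the moments passes to `booleanize`, because the recursion recovers it from them. -/
theorem booleanize_congr {Y : Type*} {F F' : WordFn Y} {l : List Y}
    (hF : ∀ l', l'.Sublist l → eval F l' = eval F' l') :
    eval (booleanize F) l = eval (booleanize F') l := by
  cases l with
  | nil => rfl
  | cons x t =>
    refine eq_of_moments (S := fun l' => l'.Sublist (x :: t))
      (fun l l' h hl => h.sublist.trans hl) (box_zeta F) (box_zeta F') ?_ x t (List.Sublist.refl _)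
    exact fun y r h => box_congr (l := y :: r) (fun l' h' => hF l' (h'.trans h)) fun _ _ => rfl

end TwoFaced

theorem theorem7 {I J : Type*} (f g : NCSeries (I ⊕ J)) :
    bReta (f.twistedBox g) = (bReta f).twistedBox (bReta g) := by
  ext n α
  have hl := pairwise_chiList (chi α)
  have hcoeff : ∀ h : NCSeries (I ⊕ J), h.coeff n α = eval (h.wordFn α) (chiList (chi α)) := by
    intro h
    have hu : (chiList (chi α)).toFinset = Finset.univ := by
      ext i
      simp [mem_chiList]
    rw [h.eval_wordFn, hu]
    exact (restr_univ (fun n (_ : Fin n → I ⊕ J) α => h.coeff n α) α α).symm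
  -- The word forms are known only on `≺`-increasing words. Sublists of `chiList` remain increasing,
  -- so the congruence lemmas allow `booleanize_box` to be applied.
  rw [hcoeff, hcoeff, wordFn_bReta _ α hl, wordFn_twistedBox _ _ α hl,
    booleanize_congr fun l' h => wordFn_twistedBox f g α (hl.sublist h), booleanize_box]
  exact box_congr (fun l' h => (wordFn_bReta f α (hl.sublist h)).symm)
    fun l' h => (wordFn_bReta g α (hl.sublist h)).symm
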